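/- Let $\mathbb N=\{0,1,2,\dots\}$, $\mathbb N^*=\{1,2,\dots\}$, $m\in\mathbb N^*$, $I_m=\{(j,\alpha)\in\mathbb N^2 : j+\alpha\le m,\ j<m\}$, and let $F(t,x,z)$, $z=(z_{j,\alpha})_{(j,\alpha)\in I_m}$, be holomorphic in a polydisk $\Delta$ centred at the origin, with $F(0,x,0)\equiv 0$ in $\Delta\cap\{t=0,z=0\}$. Write $$F(t,x,z)=a(x)t+\sum_{(j,\alpha)\in I_m} b_{j,\alpha}(x)z_{j,\alpha}+R_2(t,x,z),\qquad R_2=\sum_{i+|\nu|\ge 2}a_{i,\nu}(x)t^iz^\nu .$$ Assume $b_{j,\alpha}(x)=O(x^\alpha)$ as $x\to0$ for all $(j,\alpha)\in I_m$ with $\alpha>0$; write $b_{j,\alpha}(x)=x^\alpha c_{j,\alpha}(x)$ for $(j,\alpha)\in I_m$ and put $c_{m,0}=-1$. Define: * $L(\lambda,\rho)=\lambda^m-\sum_{(j,\alpha)\in I_m}c_{j,\alpha}(0)\lambda^j\rho(\rho-1)\cdots(\rho-\alpha+1)$; * $\Lambda_0=\{(m,0)\}\cup\{(j,\alpha)\in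 I_m : c_{j,\alpha}(0)\ne0\}$ and $\Lambda_1=\{(j,\alpha)\in I_m : c_{j,\alpha}(0)=0,\ c_{j,\alpha}\not\equiv0\}$; * the Newton polygon $\mathcal N_0\subset\mathbb R^2$, the convex hull of $\bigcup_{(j,\alpha)\in\Lambda_0}\{(x,y): x\le j,\ y\le\alpha\}$. Its boundary consists of a vertical half line, finitely many (possibly no) bounded edges, and a horizontal half line $\Gamma_{\mathrm h}$; * for a bounded edge $\Gamma$ whose left end point has abscissa $m'$, the polynomial $P_\Gamma(X)=\sum_{(j,\alpha)\in\Lambda_0\cap\Gamma}c_{j,\alpha}(0)X^{j-m'}$; for $\Gamma_{\mathrm h}$, whose end point has abscissa $m_{\mathrm h}$, the polynomial $P_{\mathrm h}(X)=\sum_{(j,\alpha)\in\Lambda_0\cap\Gamma_{\mathrm h}}c_{j,\alpha}(0)X^{j}$ if $m_{\mathrm h}\ge1$, and $P_{\mathrm h}=1$ if $m_{\mathrm h}=0$; * for $(j,\alpha)\in\Lambda_1$, $p_{j,\alpha}\ge1$, the order of the zero of $c_{j,\alpha}(x)$ at $x=0$, and $d_{j,\alpha}=\min\{y\in\mathbb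 R : (j,\alpha-y)\in\mathcal N_0\}$; then $$\sigma_0=\max\Bigl[1,\ \max_{(j,\alpha)\in\Lambda_1}\frac{p_{j,\alpha}+d_{j,\alpha}}{p_{j,\alpha}}\Bigr];$$ * for $0\le\mu<m$, $I_{m,\mu}=\{(j,\alpha)\in I_m : \alpha>\mu,\ (\partial_{z_{j,\alpha}}\partial_x^{\mu}R_2)(t,0,z)\not\equiv0\}$. Assume further * (N) $L(k,l)\neq0$ for all $(k,l)\in\mathbb N^*\times\mathbb N$; * (GP) for every bounded edge $\Gamma$ of $\mathcal N_0$ no root of $P_\Gamma$ lies in $[0,\infty)$, and no root of $P_{\mathrm h}$ lies in $\mathbb N^*$; * $\displaystyle \sigma_0\le\frac{m-j-\mu}{\alpha-\mu}$ for all $0\le\mu<m$ and all $(j,\alpha)\in I_{m,\mu}$. Then the equation $$(t\partial_t)^mu=F\bigl(t,x,\{(t\partial_t)^j\partial_x^\alpha u\}_{(j,\alpha)\in I_m}\bigr)$$ has a unique formal power series solution $u(t,x)=\sum_{k,l\ge 0}u_{k,l}t^kx^l\in\mathbb C[[t,x]]$ with $u(0,x)\equiv0$, and it lies in the formal Gevrey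 class $G\{t,x\}_{(1,\sigma_0)}$, that is, $\sum_{k,l\ge0}\frac{u_{k,l}}{l!^{\,\sigma_0-1}}t^kx^l$ converges in a neighbourhood of $(0,0)$. Consequently $u$ is holomorphic in $t$: there is $R>0$ such that for every $l\in\mathbb N$ the series $\sum_k u_{k,l}t^k$ converges to a holomorphic function on $|t|<R$. -/

import Mathlib

noncomputable section

namespace TotChar

open scoped Nat

/-! ### The equation -/

/-- The index set `I_m = {(j, α) ; j + α ≤ m, j < m}`. -/
def indexSet (m : ℕ) : Finset (ℕ × ℕ) :=
  (Finset.range m ×ˢ Finset.range (m + 1)).filter fun q => q.1 + q.2 ≤ m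

/-- The variables of `F(t, x, z)`: `t`, `x` and one variable `z_{j,α}` for each
`(j, α) ∈ I_m`. -/
abbrev Var (m : ℕ) : Type := Fin 2 ⊕ {q : ℕ × ℕ // q ∈ indexSet m}

/-- The variable `t` of `F`. -/
abbrev varT (m : ℕ) : Var m := Sum.inl 0

/-- The variable `x` of `F`. -/
abbrev varX (m : ℕ) : Var m := Sum.inl 1

/-- The variable `z_{j,α}` of `F`. -/
abbrev varZ {m : ℕ} (q : {q : ℕ × ℕ // q ∈ indexSet m}) : Var m := Sum.inr q

/-- The open polydisk with centre `0` and polyradius `r`. -/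
def polydisk {ι : Type*} (r : ι → ℝ) : Set (ι → ℂ) := {z | ∀ v, ‖z v‖ < r v}

/-- The formal Taylor series at the origin: the coefficient of `z ^ n` is `∂ⁿ F(0) / n!`. The
mixed partial derivative `∂ⁿ F(0)` is the derivative of order `|n|` of `F` at `0`, applied to
coordinate vectors, the `v`-th of which occurs `n v` times (for holomorphic `F` their order does
not matter). -/
def taylorSeries {ι : Type*} [Fintype ι] [DecidableEq ι] (F : (ι → ℂ) → ℂ) :
    MvPowerSeries ι ℂ := fun n =>
  iteratedFDeriv ℂ n.toMultiset.toList.length F 0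
      (fun i => Pi.single (n.toMultiset.toList.get i) 1) / ((∏ v, (n v)! : ℕ) : ℂ)

/-- The Euler operator `t ∂_t` on `ℂ[[t, x]]`, where `t` is the variable `0` and `x` the
variable `1`. -/
def eulerT (u : MvPowerSeries (Fin 2) ℂ) : MvPowerSeries (Fin 2) ℂ :=
  MvPowerSeries.X 0 * MvPowerSeries.pderiv ℂ 0 u

/-- The series substituted for the variables of `F`: `t` for `t`, `x` for `x`, and
`(t ∂_t)^j ∂_x^α u` for `z_{j,α}`. -/
def jet (m : ℕ) (u : MvPowerSeries (Fin 2) ℂ) : Var m → MvPowerSeries (Fin 2) ℂ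
  | Sum.inl i => MvPowerSeries.X i
  | Sum.inr q => eulerT^[q.1.1] ((MvPowerSeries.pderiv ℂ 1)^[q.1.2] u)

/-- `u ∈ ℂ[[t, x]]` is a formal solution with `u(0, x) ≡ 0` of the equation
`(t ∂_t)^m u = F(t, x, {(t ∂_t)^j ∂_x^α u}_{(j,α) ∈ I_m})`. As `u(0, x) ≡ 0`, all the series in
`jet m u` have zero constant term, so that the substitution makes sense. -/
structure IsFormalSolution {m : ℕ} (F : (Var m → ℂ) → ℂ) (u : MvPowerSeries (Fin 2) ℂ) :
    Prop where
  zero_at_t_zero : ∀ n : Fin 2 →₀ ℕ, n 0 = 0 → MvPowerSeries.coeff n u = 0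
  equation : eulerT^[m] u = MvPowerSeries.subst (jet m u) (taylorSeries F)

/-! ### The coefficients of the linear part -/

/-- The coefficient `b_{j,α}(x)` of `z_{j,α}` in the expansion of `F` in powers of `(t, z)`, as
a power series in `x`. -/
def coeffB {m : ℕ} (F : (Var m → ℂ) → ℂ) (q : {q : ℕ × ℕ // q ∈ indexSet m}) :
    PowerSeries ℂ :=
  PowerSeries.mk fun l => MvPowerSeries.coeff
    (Finsupp.single (varX m) l + Finsupp.single (varZ q) 1) (taylorSeries F)

/-- The condition `b_{j,α}(x) = O(x^α)` for all `(j, α) ∈ I_m` with `α > 0`. -/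
def TotallyCharacteristic {m : ℕ} (F : (Var m → ℂ) → ℂ) : Prop :=
  ∀ q : {q : ℕ × ℕ // q ∈ indexSet m}, 0 < q.1.2 →
    (PowerSeries.X : PowerSeries ℂ) ^ q.1.2 ∣ coeffB F q

/-- The power series `c_{j,α}(x)` with `b_{j,α}(x) = x^α c_{j,α}(x)` for `(j, α) ∈ I_m`, and
`c_{m,0} = -1`. (All other pairs get the value `0`.) -/
def coeffC {m : ℕ} (F : (Var m → ℂ) → ℂ) (q : ℕ × ℕ) : PowerSeries ℂ :=
  if h : q ∈ indexSet m then
    PowerSeries.mk fun l => PowerSeries.coeff (l + q.2) (coeffB F ⟨q, h⟩)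
  else if q = (m, 0) then -1 else 0

/-- The value `c_{j,α}(0)`. -/
def coeffC0 {m : ℕ} (F : (Var m → ℂ) → ℂ) (q : ℕ × ℕ) : ℂ :=
  PowerSeries.constantCoeff (coeffC F q)

/-- `L(λ, ρ) = λ^m - ∑_{(j,α) ∈ I_m} c_{j,α}(0) λ^j ρ (ρ - 1) ⋯ (ρ - α + 1)`. -/
def indicial {m : ℕ} (F : (Var m → ℂ) → ℂ) (lam rho : ℂ) : ℂ :=
  lam ^ m - ∑ q ∈ indexSet m,
    coeffC0 F q * lam ^ q.1 * ∏ i ∈ Finset.range q.2, (rho - (i : ℂ))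

/-- The non-resonance condition (N). -/
def NonResonance {m : ℕ} (F : (Var m → ℂ) → ℂ) : Prop :=
  ∀ k l : ℕ, 1 ≤ k → indicial F k l ≠ 0

/-! ### The Newton polygon and the generalized Poincaré condition -/

open Classical in
/-- `Λ₀ = {(m, 0)} ∪ {(j, α) ∈ I_m ; c_{j,α}(0) ≠ 0}`. -/
def lambda0 {m : ℕ} (F : (Var m → ℂ) → ℂ) : Finset (ℕ × ℕ) :=
  {(m, 0)} ∪ (indexSet m).filter fun q => coeffC0 F q ≠ 0

/-- A pair of natural numbers as a point of the plane. -/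
def toPlane (q : ℕ × ℕ) : ℝ × ℝ := (q.1, q.2)

/-- The Newton polygon at `x = 0`: the convex hull of the union of the quadrants
`{(x, y) ; x ≤ j, y ≤ α}` for `(j, α) ∈ Λ₀`. -/
def newtonPolygon {m : ℕ} (F : (Var m → ℂ) → ℂ) : Set (ℝ × ℝ) :=
  convexHull ℝ (⋃ q ∈ lambda0 F, Set.Iic (toPlane q))

/-- The face of the Newton polygon on which `s x + y` is maximal, that is, its intersection with
its supporting line of slope `-s` from above. If `s > 0` it is a vertex or one of the bounded
edges; for `s = 0` it is the horizontal half line of the boundary. -/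
def face {m : ℕ} (F : (Var m → ℂ) → ℂ) (s : ℝ) : Set (ℝ × ℝ) :=
  {P | P ∈ newtonPolygon F ∧ ∀ Q ∈ newtonPolygon F, s * Q.1 + Q.2 ≤ s * P.1 + P.2}

/-- `-s` is the slope of a bounded edge (of positive length) of the Newton polygon. -/
def IsEdgeSlope {m : ℕ} (F : (Var m → ℂ) → ℂ) (s : ℝ) : Prop :=
  0 < s ∧ (face F s).Nontrivial

open Classical in
/-- `Λ₀ ∩ Γ` for the face `Γ` of slope `-s`. -/
def lambda0Face {m : ℕ} (F : (Var m → ℂ) → ℂ) (s : ℝ) : Finset (ℕ × ℕ) :=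
  (lambda0 F).filter fun q => toPlane q ∈ face F s

/-- The abscissa of the left end point of the bounded edge of slope `-s`; the end points of the
edges are vertices of the polygon, hence points of `Λ₀`. -/
def leftEnd {m : ℕ} (F : (Var m → ℂ) → ℂ) (s : ℝ) : ℕ :=
  sInf {j : ℕ | ∃ q ∈ lambda0Face F s, q.1 = j}

/-- The characteristic polynomial `∑_{(j,α) ∈ Λ₀ ∩ Γ} c_{j,α}(0) X^{j - m'}` on the bounded edge
`Γ` of slope `-s`, with `m'` the abscissa of its left end point. -/
def charPoly {m : ℕ} (F : (Var m → ℂ) → ℂ) (s : ℝ) : Polynomial ℂ :=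
  ∑ q ∈ lambda0Face F s,
    Polynomial.C (coeffC0 F q) * Polynomial.X ^ (q.1 - leftEnd F s)

/-- The abscissa `m_p` of the end point of the horizontal half line of the boundary. -/
def lastAbscissa {m : ℕ} (F : (Var m → ℂ) → ℂ) : ℕ := (lambda0Face F 0).sup fun q => q.1

/-- The characteristic polynomial on the horizontal half line `Γ_p` of the boundary: `1` if
`m_p = 0`, and `∑_{(j,α) ∈ Λ₀ ∩ Γ_p} c_{j,α}(0) X^j` if `m_p ≥ 1`. -/
def lastCharPoly {m : ℕ} (F : (Var m → ℂ) → ℂ) : Polynomial ℂ :=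
  if lastAbscissa F = 0 then 1
  else ∑ q ∈ lambda0Face F 0, Polynomial.C (coeffC0 F q) * Polynomial.X ^ q.1

/-- The generalized Poincaré condition (GP): no characteristic root on a bounded edge lies in
`[0, ∞)`, and no characteristic root on the horizontal half line lies in `{1, 2, 3, …}`. -/
structure GeneralizedPoincare {m : ℕ} (F : (Var m → ℂ) → ℂ) : Prop where
  edges : ∀ s : ℝ, IsEdgeSlope F s → ∀ lam : ℂ, (charPoly F s).IsRoot lam →
    ¬ ∃ a : ℝ, 0 ≤ a ∧ lam = (a : ℂ)
  last : ∀ lam : ℂ, (lastCharPoly F).IsRoot lam → ¬ ∃ k : ℕ, 1 ≤ k ∧ lam = (k : ℂ)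

/-! ### The irregularity at `x = 0` -/

/-- `Λ₁ = {(j, α) ∈ I_m ; c_{j,α}(0) = 0, c_{j,α}(x) ≢ 0}`. -/
def lambda1 {m : ℕ} (F : (Var m → ℂ) → ℂ) : Set (ℕ × ℕ) :=
  {q | q ∈ indexSet m ∧ coeffC0 F q = 0 ∧ coeffC F q ≠ 0}

/-- `p_{j,α}`, the order of the zero of `c_{j,α}(x)` at `x = 0`. -/
def zeroOrder {m : ℕ} (F : (Var m → ℂ) → ℂ) (q : ℕ × ℕ) : ℕ := (coeffC F q).order.toNat

/-- `d_{j,α} = min {y ∈ ℝ ; (j, α - y) ∈ N₀}`. -/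
def excess {m : ℕ} (F : (Var m → ℂ) → ℂ) (q : ℕ × ℕ) : ℝ :=
  sInf {y : ℝ | ((q.1 : ℝ), (q.2 : ℝ) - y) ∈ newtonPolygon F}

/-- The irregularity `σ₀` at `x = 0`: the maximum of `1` and of the numbers
`(p_{j,α} + d_{j,α}) / p_{j,α}` for `(j, α) ∈ Λ₁` (a finite set). -/
def irregularity {m : ℕ} (F : (Var m → ℂ) → ℂ) : ℝ :=
  sSup (insert 1 ((fun q => ((zeroOrder F q : ℝ) + excess F q) / (zeroOrder F q : ℝ)) ''
    lambda1 F))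

/-! ### The nonlinear part -/

/-- `R₂(t, x, z)`: the part of the expansion of `F` in powers of `(t, z)` which consists of the
terms `a_{i,ν}(x) t^i z^ν` with `i + |ν| ≥ 2`. -/
def nonlinearPart {m : ℕ} (F : (Var m → ℂ) → ℂ) : MvPowerSeries (Var m) ℂ := fun n =>
  if 2 ≤ n (varT m) + ∑ q, n (varZ q) then MvPowerSeries.coeff n (taylorSeries F) else 0

/-- The restriction `f(t, 0, z)` of `f(t, x, z)` to `x = 0`. -/
def restrictX {m : ℕ} (f : MvPowerSeries (Var m) ℂ) : MvPowerSeries (Var m) ℂ := fun n =>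
  if n (varX m) = 0 then MvPowerSeries.coeff n f else 0

/-- `I_{m,μ} = {(j, α) ∈ I_m ; α > μ, (∂_{z_{j,α}} ∂_x^μ R₂)(t, 0, z) ≢ 0}`. -/
def indexSetMu {m : ℕ} (F : (Var m → ℂ) → ℂ) (mu : ℕ) :
    Set {q : ℕ × ℕ // q ∈ indexSet m} :=
  {q | mu < q.1.2 ∧
    restrictX (MvPowerSeries.pderiv ℂ (varZ q)
      ((MvPowerSeries.pderiv ℂ (varX m))^[mu] (nonlinearPart F))) ≠ 0}

/-! ### Formal Gevrey classes -/

/-- The coefficient `u_{k,l}` of `t^k x^l`. -/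
def coeffTX (u : MvPowerSeries (Fin 2) ℂ) (k l : ℕ) : ℂ :=
  MvPowerSeries.coeff (Finsupp.single 0 k + Finsupp.single 1 l) u

/-- The formal Gevrey class `G{t, x}_{(s,σ)}` (for `s, σ ≥ 1`): the series `∑ u_{k,l} t^k x^l`
such that `∑ u_{k,l} / (k!^{s-1} l!^{σ-1}) t^k x^l` converges in a neighbourhood of `(0, 0)`. -/
def gevreyClass (s σ : ℝ) : Set (MvPowerSeries (Fin 2) ℂ) :=
  {u | ∀ᶠ P : ℂ × ℂ in nhds 0, Summable fun n : ℕ × ℕ =>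
    coeffTX u n.1 n.2 / (((n.1 ! : ℝ) ^ (s - 1) * (n.2 ! : ℝ) ^ (σ - 1) : ℝ) : ℂ) *
      P.1 ^ n.1 * P.2 ^ n.2}

/-- `u(t, x)` is holomorphic in `t`: when it is written as a power series `∑ g_l(t) x^l` in `x`,
the coefficients `g_l(t) = ∑_k u_{k,l} t^k` converge to holomorphic functions on a common disk
with centre `0`. -/
def HolomorphicInT (u : MvPowerSeries (Fin 2) ℂ) : Prop :=
  ∃ R : ℝ, 0 < R ∧ ∃ g : ℕ → ℂ → ℂ, ∀ l : ℕ, DifferentiableOn ℂ (g l) (Metric.ball 0 R) ∧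
    ∀ t ∈ Metric.ball (0 : ℂ) R, HasSum (fun k : ℕ => coeffTX u k l * t ^ k) (g l t)

end TotChar

end

/-!
Comparing the coefficients of `t ^ k * x ^ l` turns the equation into a recursion
`L(k, l) * u_{k,l} = …`, whose right-hand side involves the higher Taylor coefficients of the
`c_{j,α}` (applied to `u_{k,l'}` with `l' < l`) and the monomials of `F` which contain `t` or at
least two of the variables `z` (applied to `u_{k',l'}` with `k' < k`). Condition (N) makes the
recursion solvable.

For the Gevrey bound, (N) and (GP) imply `|L(k, l)| ≥ C * k ^ j * l ^ α` for every `(j, α)` in the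
Newton polygon: for large `k + l` the terms of `L(k, l)` which are not negligible lie near one face,
selected by the ratio of `log k` and `log l`, and the polynomial of that face does not vanish. If
`c_{j,α}` vanishes to order `p` and `(j, α)` exceeds the polygon by `d`, then the excess `l ^ d` is
paid for by the drop `l' ≤ l - p`, which gains `(l! / (l - p)!) ^ (σ₀ - 1)`. In the nonlinear terms,
majorants are of the form `∑ (a)_l ^ σ₀ * x ^ l / l!` with `a` growing linearly in `k`; there,
`∂_x ^ α` behind a factor `x ^ μ` costs at most `k ^ (σ₀ * (α - μ))`, and the last hypothesis
bounds this by `k ^ (m - j - μ)`. A large rate in `x` absorbs the linear terms, and then a large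
rate in `t` absorbs the nonlinear ones.
-/

noncomputable section

namespace TotChar

open Finset Filter Topology
open scoped Nat

/-! ### Coefficients of series in two variables -/

theorem exponent_eq (n : Fin 2 →₀ ℕ) :
    Finsupp.single 0 (n 0) + Finsupp.single 1 (n 1) = n := by
  ext i; fin_cases i <;> simp

theorem coeff_eq_coeffTX (f : MvPowerSeries (Fin 2) ℂ) (n : Fin 2 →₀ ℕ) :
    MvPowerSeries.coeff n f = coeffTX f (n 0) (n 1) := by
  rw [coeffTX, exponent_eq]

theorem ext_coeffTX {f g : MvPowerSeries (Fin 2) ℂ}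
    (h : ∀ k l, coeffTX f k l = coeffTX g k l) : f = g := by
  ext n; rw [coeff_eq_coeffTX, coeff_eq_coeffTX, h]

/-- The series `∑ c_{k,l} t^k x^l` with prescribed coefficients. -/
def ofCoeff (c : ℕ → ℕ → ℂ) : MvPowerSeries (Fin 2) ℂ := fun n => c (n 0) (n 1)

@[simp] theorem coeffTX_ofCoeff (c : ℕ → ℕ → ℂ) (k l : ℕ) : coeffTX (ofCoeff c) k l = c k l := by
  simp [coeffTX, ofCoeff, MvPowerSeries.coeff_apply]

theorem coeffTX_one (k l : ℕ) : coeffTX 1 k l = if k = 0 ∧ l = 0 then 1 else 0 := by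
  simp [coeffTX, MvPowerSeries.coeff_one, Finsupp.ext_iff, Fin.forall_fin_two]

theorem coeffTX_mul (f g : MvPowerSeries (Fin 2) ℂ) (k l : ℕ) :
    coeffTX (f * g) k l = ∑ a ∈ antidiagonal k, ∑ b ∈ antidiagonal l,
      coeffTX f a.1 b.1 * coeffTX g a.2 b.2 := by
  rw [coeffTX, MvPowerSeries.coeff_mul, ← Finset.sum_product']
  refine Finset.sum_bij' (fun p _ => ((p.1 0, p.2 0), (p.1 1, p.2 1)))
    (fun a _ => (Finsupp.single 0 a.1.1 + Finsupp.single 1 a.2.1,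
      Finsupp.single 0 a.1.2 + Finsupp.single 1 a.2.2)) ?_ ?_ ?_ ?_ ?_
  · intro p hp
    simpa [Finsupp.ext_iff, Fin.forall_fin_two] using hp
  · intro a ha
    simpa [Finsupp.ext_iff, Fin.forall_fin_two] using ha
  · intro p _; simp [exponent_eq]
  · intro a _; simp
  · intro p _; simp [coeff_eq_coeffTX]

theorem coeffTX_X_zero_pow_mul (i : ℕ) (f : MvPowerSeries (Fin 2) ℂ) (k l : ℕ) :
    coeffTX (MvPowerSeries.X 0 ^ i * f) k l = if i ≤ k then coeffTX f (k - i) l else 0 := by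
  rw [coeffTX, MvPowerSeries.X_pow_eq, MvPowerSeries.coeff_monomial_mul, one_mul, coeff_eq_coeffTX]
  simp [Finsupp.le_def, Fin.forall_fin_two]

theorem coeffTX_X_one_pow_mul (i : ℕ) (f : MvPowerSeries (Fin 2) ℂ) (k l : ℕ) :
    coeffTX (MvPowerSeries.X 1 ^ i * f) k l = if i ≤ l then coeffTX f k (l - i) else 0 := by
  rw [coeffTX, MvPowerSeries.X_pow_eq, MvPowerSeries.coeff_monomial_mul, one_mul, coeff_eq_coeffTX]
  simp [Finsupp.le_def, Fin.forall_fin_two]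

theorem coeff_iterate_pderiv {ι R : Type*} [CommSemiring R] (i : ι) (a : ℕ) (f : MvPowerSeries ι R)
    (n : ι →₀ ℕ) :
    MvPowerSeries.coeff n ((MvPowerSeries.pderiv R i)^[a] f) =
      (n i + a).descFactorial a * MvPowerSeries.coeff (n + Finsupp.single i a) f := by
  induction a generalizing n with
  | zero => simp
  | succ a ih =>
    rw [Function.iterate_succ_apply', MvPowerSeries.coeff_pderiv, ih, add_assoc,
      ← Finsupp.single_add, Finsupp.add_apply, Finsupp.single_eq_same, Nat.descFactorial_succ,
      show n i + 1 + a = n i + (a + 1) by ring, show n i + (a + 1) - a = n i + 1 by omega,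
      add_comm 1 a]
    push_cast; ring

theorem coeffTX_iterate_pderiv_one (a : ℕ) (f : MvPowerSeries (Fin 2) ℂ) (k l : ℕ) :
    coeffTX ((MvPowerSeries.pderiv ℂ 1)^[a] f) k l =
      ((l + a).descFactorial a : ℂ) * coeffTX f k (l + a) := by
  rw [coeffTX, coeff_iterate_pderiv, coeff_eq_coeffTX]
  simp

theorem coeffTX_eulerT (f : MvPowerSeries (Fin 2) ℂ) (k l : ℕ) :
    coeffTX (eulerT f) k l = k * coeffTX f k l := by
  rw [eulerT, ← pow_one (MvPowerSeries.X 0), coeffTX_X_zero_pow_mul]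
  rcases k with _ | k
  · simp
  · rw [if_pos (by omega), coeffTX, MvPowerSeries.coeff_pderiv, coeff_eq_coeffTX]
    simp [mul_comm]

theorem coeffTX_iterate_eulerT (j : ℕ) (f : MvPowerSeries (Fin 2) ℂ) (k l : ℕ) :
    coeffTX (eulerT^[j] f) k l = (k : ℂ) ^ j * coeffTX f k l := by
  induction j with
  | zero => simp
  | succ j ih => rw [Function.iterate_succ_apply', coeffTX_eulerT, ih]; ring

theorem coeffTX_jet_varZ {m : ℕ} (u : MvPowerSeries (Fin 2) ℂ)
    (q : {q : ℕ × ℕ // q ∈ indexSet m}) (k l : ℕ) :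
    coeffTX (jet m u (varZ q)) k l =
      (k : ℂ) ^ q.1.1 * (((l + q.1.2).descFactorial q.1.2 : ℂ) * coeffTX u k (l + q.1.2)) := by
  rw [jet, coeffTX_iterate_eulerT, coeffTX_iterate_pderiv_one]

theorem coeffTX_subst_X_one_mul (b : PowerSeries ℂ) (f : MvPowerSeries (Fin 2) ℂ) (k l : ℕ) :
    coeffTX (b.subst (MvPowerSeries.X 1 : MvPowerSeries (Fin 2) ℂ) * f) k l =
      ∑ p ∈ antidiagonal l, PowerSeries.coeff p.1 b * coeffTX f k p.2 := by
  have hcoeff : ∀ i j, coeffTX (b.subst (MvPowerSeries.X 1 : MvPowerSeries (Fin 2) ℂ)) i j =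
      if i = 0 then PowerSeries.coeff j b else 0 := fun i j => by
    rw [coeffTX, PowerSeries.coeff_subst_single]
    simp [Finsupp.ext_iff, Fin.forall_fin_two]
  rw [coeffTX_mul, Finset.sum_eq_single (0, k)]
  · simp [hcoeff]
  · intro a ha hne
    have : a.1 ≠ 0 := fun h => hne (Prod.ext h (by simpa [h] using ha))
    simp [hcoeff, this]
  · simp

theorem mem_indexSet {m : ℕ} {q : ℕ × ℕ} : q ∈ indexSet m ↔ q.1 + q.2 ≤ m ∧ q.1 < m := by
  simp only [indexSet, mem_filter, mem_product, mem_range]; omega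

/-! ### The formal Taylor series -/

theorem multinomial_le_card_pow {ι : Type*} [Fintype ι] (n : ι → ℕ) :
    Nat.multinomial univ n ≤ Fintype.card ι ^ (∑ v, n v) := by
  classical
  have h := Finset.sum_pow_eq_sum_piAntidiag (univ : Finset ι) (fun _ => (1 : ℕ)) (∑ v, n v)
  simp only [sum_const, smul_eq_mul, mul_one, one_pow, prod_const_one, card_univ] at h
  rw [h]
  exact Finset.single_le_sum (f := fun k => Nat.multinomial univ k) (fun _ _ => Nat.zero_le _)
    (by simp)

theorem length_toList_toMultiset {ι : Type*} [Fintype ι] (n : ι →₀ ℕ) :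
    n.toMultiset.toList.length = ∑ v, n v := by
  rw [Multiset.length_toList, Finsupp.card_toMultiset, Finsupp.sum_fintype _ _ (fun _ => rfl)]
  rfl

theorem exists_norm_iteratedFDeriv_le {𝕜 E G : Type*} [NontriviallyNormedField 𝕜]
    [NormedAddCommGroup E] [NormedSpace 𝕜 E] [NormedAddCommGroup G] [NormedSpace 𝕜 G]
    [CompleteSpace G] {f : E → G} {x : E} (hf : AnalyticAt 𝕜 f x) :
    ∃ K ρ : ℝ, 0 < K ∧ 0 < ρ ∧ ∀ n, ‖iteratedFDeriv 𝕜 n f x‖ ≤ n ! * (K * ρ ^ n) := by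
  obtain ⟨p, R, hp⟩ := hf
  obtain ⟨r, hr0, hr⟩ := ENNReal.lt_iff_exists_nnreal_btwn.1 (hp.r_pos.trans_le hp.r_le)
  have hr0 : 0 < r := by exact_mod_cast hr0
  obtain ⟨K, hK, hpK⟩ := p.norm_le_div_pow_of_pos_of_lt_radius hr0 hr
  refine ⟨K, (r : ℝ)⁻¹, hK, by positivity, fun n =>
    ContinuousMultilinearMap.opNorm_le_bound (by positivity) fun v => ?_⟩
  rw [hp.iteratedFDeriv_eq_sum_of_completeSpace]
  have hterm (σ : Equiv.Perm (Fin n)) :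
      ‖p n fun i => v (σ i)‖ ≤ K * (r : ℝ)⁻¹ ^ n * ∏ i, ‖v i‖ := by
    rw [← Equiv.prod_comp σ fun i => ‖v i‖, inv_pow, ← div_eq_mul_inv]
    exact (p n).le_of_opNorm_le (hpK n) _
  refine (norm_sum_le_of_le _ fun σ _ => hterm σ).trans_eq ?_
  rw [sum_const, card_univ, Fintype.card_perm, Fintype.card_fin, nsmul_eq_mul]
  ring

theorem exists_norm_coeff_taylorSeries_le {ι : Type*} [Fintype ι] [DecidableEq ι]
    {F : (ι → ℂ) → ℂ} (hF : AnalyticAt ℂ F 0) :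
    ∃ K ρ : ℝ, 0 < K ∧ 0 < ρ ∧
      ∀ n, ‖MvPowerSeries.coeff n (taylorSeries F)‖ ≤ K * ρ ^ (∑ v, n v) := by
  obtain ⟨K, ρ, hK, hρ, hder⟩ := exists_norm_iteratedFDeriv_le hF
  refine ⟨K, (Fintype.card ι + 1) * ρ, hK, by positivity, fun n => ?_⟩
  set s := ∑ v, n v with hs
  have hfac : (s ! : ℝ) = ((∏ v, (n v)! : ℕ) : ℝ) * Nat.multinomial univ n := by
    rw [← Nat.cast_mul, Nat.multinomial_spec]
  have hmul : (Nat.multinomial univ n : ℝ) ≤ (Fintype.card ι + 1 : ℝ) ^ s := by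
    exact_mod_cast (multinomial_le_card_pow n).trans (Nat.pow_le_pow_left (Nat.le_succ _) _)
  have hpos : (0 : ℝ) < ((∏ v, (n v)! : ℕ) : ℝ) :=
    Nat.cast_pos.2 (Finset.prod_pos fun v _ => Nat.factorial_pos _)
  rw [MvPowerSeries.coeff_apply, taylorSeries, norm_div, Complex.norm_natCast, div_le_iff₀ hpos]
  calc _ ≤ (s ! : ℝ) * (K * ρ ^ s) * 1 := by
        rw [hs, ← length_toList_toMultiset]
        refine (ContinuousMultilinearMap.le_opNorm _ _).trans ?_
        gcongr
        · exact hder _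
        · exact (Finset.prod_eq_one fun i _ => by rw [Pi.norm_single, norm_one]).le
    _ = Nat.multinomial univ n * (K * ρ ^ s * ((∏ v, (n v)! : ℕ) : ℝ)) := by rw [hfac]; ring
    _ ≤ (Fintype.card ι + 1 : ℝ) ^ s * (K * ρ ^ s * ((∏ v, (n v)! : ℕ) : ℝ)) := by gcongr
    _ = _ := by rw [mul_pow]; ring

theorem coeff_taylorSeries_single_eq_zero {ι : Type*} [Fintype ι] [DecidableEq ι]
    {F : (ι → ℂ) → ℂ} (hF : AnalyticAt ℂ F 0) (v : ι)
    (h0 : ∀ᶠ x : ℂ in 𝓝 0, F (Pi.single v x) = 0) (l : ℕ) :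
    MvPowerSeries.coeff (Finsupp.single v l) (taylorSeries F) = 0 := by
  obtain ⟨p, R, hp⟩ := hF
  let L : ℂ →L[ℂ] (ι → ℂ) := ContinuousLinearMap.single ℂ (fun _ => ℂ) v
  have hz : p.compContinuousLinearMap L = 0 := by
    have hpL : HasFPowerSeriesAt F p (L 0) := by simpa using hp.hasFPowerSeriesAt
    refine HasFPowerSeriesAt.eq_zero ((hpL.compContinuousLinearMap (u := L)).congr ?_)
    filter_upwards [h0] with x hx using hx
  have hget i : (Finsupp.single v l).toMultiset.toList.get i = v := by
    have hmem := Multiset.mem_toList.1 (List.get_mem (Finsupp.single v l).toMultiset.toList i)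
    exact ((Finsupp.mem_support_single _ _ _).1 ((Finsupp.mem_toMultiset _ _).1 hmem)).1
  rw [MvPowerSeries.coeff_apply, taylorSeries, hp.iteratedFDeriv_eq_sum_of_completeSpace]
  simp only [hget]
  rw [Finset.sum_eq_zero, zero_div]
  exact fun σ _ => congrArg
    (fun q : ContinuousMultilinearMap ℂ (fun _ => ℂ) ℂ => q fun _ => 1) (congrFun hz _)

theorem single_mem_polydisk {ι : Type*} [DecidableEq ι] {r : ι → ℝ} (hr : ∀ v, 0 < r v) {v : ι}
    {x : ℂ} (hx : ‖x‖ < r v) : Pi.single v x ∈ polydisk r := fun w => by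
  obtain rfl | hw := eq_or_ne w v
  · simpa using hx
  · simpa [hw] using hr w

/-! ### Substitution of a jet -/

/-- The series `u / t`, for `u` without terms of order `0` in `t`. -/
def shiftT (u : MvPowerSeries (Fin 2) ℂ) : MvPowerSeries (Fin 2) ℂ :=
  ofCoeff fun k l => coeffTX u (k + 1) l

theorem X_zero_mul_shiftT {u : MvPowerSeries (Fin 2) ℂ} (hu : ∀ l, coeffTX u 0 l = 0) :
    MvPowerSeries.X 0 * shiftT u = u := by
  refine ext_coeffTX fun k l => ?_
  rw [← pow_one (MvPowerSeries.X 0), coeffTX_X_zero_pow_mul, shiftT, coeffTX_ofCoeff]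
  cases k with
  | zero => simp [hu]
  | succ k => simp

section Substitution

variable {m : ℕ}

theorem coeffTX_jet_varZ_zero {u : MvPowerSeries (Fin 2) ℂ} (hu : ∀ l, coeffTX u 0 l = 0)
    (q : {q : ℕ × ℕ // q ∈ indexSet m}) (l : ℕ) : coeffTX (jet m u (varZ q)) 0 l = 0 := by
  rw [coeffTX_jet_varZ, hu, mul_zero, mul_zero]

theorem hasSubst_jet {u : MvPowerSeries (Fin 2) ℂ} (hu : ∀ l, coeffTX u 0 l = 0) :
    MvPowerSeries.HasSubst (jet m u) := by
  refine MvPowerSeries.hasSubst_of_constantCoeff_zero fun v => ?_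
  rcases v with i | q
  · simp [jet]
  · simpa [coeffTX] using coeffTX_jet_varZ_zero hu q 0

/-- The total degree of a monomial in the variables `z_{j,α}`. -/
def zDegree (n : Var m → ℕ) : ℕ := ∑ q, n (varZ q)

theorem le_zDegree (n : Var m → ℕ) (q : {q : ℕ × ℕ // q ∈ indexSet m}) :
    n (varZ q) ≤ zDegree n :=
  Finset.single_le_sum (f := fun q => n (varZ q)) (fun _ _ => Nat.zero_le _) (mem_univ q)

/-- The product of the powers `((t ∂_t)^j ∂_x^α u / t)^{ν_{j,α}}`. -/
def zMonomial (u : MvPowerSeries (Fin 2) ℂ) (n : Var m → ℕ) : MvPowerSeries (Fin 2) ℂ :=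
  ∏ q, shiftT (jet m u (varZ q)) ^ n (varZ q)

theorem zMonomial_of_zDegree_eq_zero (u : MvPowerSeries (Fin 2) ℂ) {n : Var m → ℕ}
    (hn : zDegree n = 0) : zMonomial u n = 1 := by
  have hz : ∀ q, n (varZ q) = 0 := fun q => Nat.le_zero.1 (hn ▸ le_zDegree n q)
  simp [zMonomial, hz]

/-- The monomial of exponent `n` evaluated at the jet of `u`, with the powers of `t` contributed
by the derivatives of `u` collected in front. -/
def jetMonomial (u : MvPowerSeries (Fin 2) ℂ) (n : Var m → ℕ) : MvPowerSeries (Fin 2) ℂ :=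
  MvPowerSeries.X 0 ^ (n (varT m) + zDegree n) *
    (MvPowerSeries.X 1 ^ n (varX m) * zMonomial u n)

theorem prod_jet_pow {u : MvPowerSeries (Fin 2) ℂ} (hu : ∀ l, coeffTX u 0 l = 0)
    (n : Var m → ℕ) : ∏ v, jet m u v ^ n v = jetMonomial u n := by
  have hz (q) : jet m u (Sum.inr q) ^ n (Sum.inr q) = MvPowerSeries.X 0 ^ n (Sum.inr q) *
      shiftT (jet m u (varZ q)) ^ n (Sum.inr q) := by
    rw [← mul_pow, X_zero_mul_shiftT (coeffTX_jet_varZ_zero hu q)]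
  rw [Fintype.prod_sum_type, Fin.prod_univ_two, Finset.prod_congr rfl (fun q _ => hz q),
    Finset.prod_mul_distrib, Finset.prod_pow_eq_pow_sum, jetMonomial, zMonomial, zDegree, pow_add]
  simp only [jet]
  ring

theorem coeffTX_jetMonomial (u : MvPowerSeries (Fin 2) ℂ) (n : Var m → ℕ) (k l : ℕ) :
    coeffTX (jetMonomial u n) k l =
      if n (varT m) + zDegree n ≤ k then if n (varX m) ≤ l then
        coeffTX (zMonomial u n) (k - (n (varT m) + zDegree n)) (l - n (varX m))
      else 0 else 0 := by
  rw [jetMonomial, coeffTX_X_zero_pow_mul, coeffTX_X_one_pow_mul]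

/-- The exponents at most `N` in each variable. -/
def box (m N : ℕ) : Finset (Var m → ℕ) := Fintype.piFinset fun _ => range (N + 1)

theorem mem_box_of_coeffTX_jetMonomial_ne_zero {u : MvPowerSeries (Fin 2) ℂ} {n : Var m → ℕ}
    {k l : ℕ} (h : coeffTX (jetMonomial u n) k l ≠ 0) : n ∈ box m (k + l) := by
  rw [coeffTX_jetMonomial] at h
  have hk : n (varT m) + zDegree n ≤ k := by by_contra hk; simp [hk] at h
  have hl : n (varX m) ≤ l := by by_contra hl; simp [hl] at h
  simp only [box, Fintype.mem_piFinset, mem_range, Order.lt_add_one_iff]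
  rintro (i | q)
  · fin_cases i
    · exact (Nat.le_add_right _ _).trans (hk.trans (Nat.le_add_right k l))
    · exact hl.trans (Nat.le_add_left l k)
  · exact (le_zDegree n q).trans (by omega)

/-- The Taylor coefficients of `F` at the origin. -/
def taylorCoeff (F : (Var m → ℂ) → ℂ) (n : Var m → ℕ) : ℂ :=
  MvPowerSeries.coeff (Finsupp.equivFunOnFinite.symm n) (taylorSeries F)

/-- A monomial which is not of the form `x^p` or `x^p z_{j,α}`. -/
def IsRest (n : Var m → ℕ) : Prop := 1 ≤ n (varT m) ∨ 2 ≤ zDegree n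

instance : DecidablePred (IsRest (m := m)) := fun n =>
  inferInstanceAs (Decidable (1 ≤ n (varT m) ∨ 2 ≤ zDegree n))

/-- The sum of the terms of `F(t, x, z)` that are not of the form `a x^p` or `b x^p z_{j,α}`. -/
def restPart (F : (Var m → ℂ) → ℂ) : MvPowerSeries (Var m) ℂ := fun n =>
  if IsRest n then MvPowerSeries.coeff n (taylorSeries F) else 0

/-- The coefficient of `t^k x^l` in `restPart F` evaluated at the jet of `u`; it is a finite sum
as `u` vanishes at `t = 0`. -/
def rest (F : (Var m → ℂ) → ℂ) (u : MvPowerSeries (Fin 2) ℂ) (k l : ℕ) : ℂ :=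
  ∑ n ∈ (box m (k + l)).filter IsRest, taylorCoeff F n * coeffTX (jetMonomial u n) k l

theorem coeffTX_subst_restPart (F : (Var m → ℂ) → ℂ) {u : MvPowerSeries (Fin 2) ℂ}
    (hu : ∀ l, coeffTX u 0 l = 0) (k l : ℕ) :
    coeffTX (MvPowerSeries.subst (jet m u) (restPart F)) k l = rest F u k l := by
  have hprod (n : Var m → ℕ) : (Finsupp.equivFunOnFinite.symm n).prod (fun s e => jet m u s ^ e) =
      jetMonomial u n := by
    rw [Finsupp.prod_fintype _ _ (fun _ => pow_zero _), ← prod_jet_pow hu]; rfl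
  have hcoeff (n : Var m → ℕ) :
      MvPowerSeries.coeff (Finsupp.equivFunOnFinite.symm n) (restPart F) =
        if IsRest n then taylorCoeff F n else 0 := rfl
  rw [coeffTX, MvPowerSeries.coeff_subst (hasSubst_jet hu),
    ← finsum_comp_equiv (Finsupp.equivFunOnFinite : (Var m →₀ ℕ) ≃ (Var m → ℕ)).symm, rest,
    Finset.sum_filter]
  simp only [hprod, hcoeff, smul_eq_mul, ite_mul, zero_mul]
  refine finsum_eq_sum_of_support_subset _ fun n hn =>
    mem_box_of_coeffTX_jetMonomial_ne_zero (u := u) fun h0 => hn ?_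
  change (if IsRest n then taylorCoeff F n * coeffTX (jetMonomial u n) k l else 0) = 0
  rw [h0, mul_zero, ite_self]

/-! ### The linear part -/

/-- The exponent of `x^p z_{j,α}`. -/
def linExponent (q : {q : ℕ × ℕ // q ∈ indexSet m}) (p : ℕ) : Var m →₀ ℕ :=
  Finsupp.single (varX m) p + Finsupp.single (varZ q) 1

theorem not_isRest_linExponent (q : {q : ℕ × ℕ // q ∈ indexSet m}) (p : ℕ) :
    ¬ IsRest (linExponent q p) := by
  simp [IsRest, zDegree, linExponent, Finsupp.single_apply]

theorem linExponent_eq_linExponent {q q' : {q : ℕ × ℕ // q ∈ indexSet m}} {p p' : ℕ} :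
    linExponent q p = linExponent q' p' ↔ q = q' ∧ p = p' := by
  refine ⟨fun h => ⟨?_, ?_⟩, by rintro ⟨rfl, rfl⟩; rfl⟩
  · simpa [linExponent, Finsupp.single_apply, eq_comm] using DFunLike.congr_fun h (varZ q)
  · simpa [linExponent] using DFunLike.congr_fun h (varX m)

theorem eq_single_or_eq_linExponent_of_not_isRest {n : Var m →₀ ℕ} (hn : ¬ IsRest n) :
    n = Finsupp.single (varX m) (n (varX m)) ∨ ∃ q, n = linExponent q (n (varX m)) := by
  obtain ⟨hT, hz⟩ : n (varT m) = 0 ∧ zDegree n ≤ 1 := by simp only [IsRest] at hn; omega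
  let z : {q : ℕ × ℕ // q ∈ indexSet m} →₀ ℕ := Finsupp.equivFunOnFinite.symm fun q => n (varZ q)
  have hsum : z.sum (fun _ i => i) = zDegree n := Finsupp.sum_fintype _ _ fun _ => rfl
  rcases Nat.le_one_iff_eq_zero_or_eq_one.1 hz with hz | hz
  · refine Or.inl (Finsupp.ext ?_)
    rintro (i | q)
    · fin_cases i <;> simp [hT]
    · simpa [Finsupp.single_apply, hz] using le_zDegree n q
  · obtain ⟨q, hq⟩ := (Finsupp.sum_eq_one_iff z).1 (hsum.trans hz)
    refine Or.inr ⟨q, Finsupp.ext ?_⟩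
    rintro (i | q')
    · fin_cases i <;> simp [linExponent, hT]
    · simpa [linExponent, Finsupp.single_apply, z] using DFunLike.congr_fun hq q'

theorem coeff_coeffB_subst_mul_X (F : (Var m → ℂ) → ℂ) (q : {q : ℕ × ℕ // q ∈ indexSet m})
    (n : Var m →₀ ℕ) :
    MvPowerSeries.coeff n ((coeffB F q).subst (MvPowerSeries.X (varX m) : MvPowerSeries (Var m) ℂ) *
        MvPowerSeries.X (varZ q)) =
      if n = linExponent q (n (varX m)) then MvPowerSeries.coeff n (taylorSeries F) else 0 := by
  rw [MvPowerSeries.X_def (varZ q), MvPowerSeries.coeff_mul_monomial, mul_one,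
    PowerSeries.coeff_subst_single, ← ite_and]
  rw [show (n - Finsupp.single (varZ q) 1 : Var m →₀ ℕ) (varX m) = n (varX m) by simp]
  have hiff : (Finsupp.single (varZ q) 1 ≤ n ∧
      n - Finsupp.single (varZ q) 1 = Finsupp.single (varX m) (n (varX m))) ↔
      n = linExponent q (n (varX m)) := by
    constructor
    · rintro ⟨hle, h⟩
      rw [linExponent, ← h, tsub_add_cancel_of_le hle]
    · intro h
      constructor
      · rw [h]; exact le_add_self
      · conv_lhs => rw [h, linExponent, add_tsub_cancel_right]
  refine ite_congr (propext hiff) (fun h => ?_) fun _ => rfl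
  conv_rhs => rw [h]
  rw [coeffB, PowerSeries.coeff_mk, linExponent]

theorem taylorSeries_eq_sum_add_restPart {F : (Var m → ℂ) → ℂ}
    (h0 : ∀ l, MvPowerSeries.coeff (Finsupp.single (varX m) l) (taylorSeries F) = 0) :
    taylorSeries F =
      ∑ q, (coeffB F q).subst (MvPowerSeries.X (varX m) : MvPowerSeries (Var m) ℂ) *
        MvPowerSeries.X (varZ q) + restPart F := by
  ext n
  have hrest : MvPowerSeries.coeff n (restPart F) =
    if IsRest n then MvPowerSeries.coeff n (taylorSeries F) else 0 := rfl
  simp only [map_add, map_sum, coeff_coeffB_subst_mul_X, hrest]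
  by_cases hn : IsRest n
  · rw [if_pos hn, Finset.sum_eq_zero, zero_add]
    exact fun q _ => if_neg fun h => not_isRest_linExponent q _ (h ▸ hn)
  rw [if_neg hn, add_zero]
  rcases eq_single_or_eq_linExponent_of_not_isRest hn with h | ⟨q, h⟩
  · rw [h, h0]; simp
  · rw [Finset.sum_eq_single q, if_pos h]
    · exact fun q' _ hne => if_neg fun h' => hne (linExponent_eq_linExponent.1 (h'.symm.trans h)).1
    · simp

theorem coeff_coeffC (F : (Var m → ℂ) → ℂ) (q : {q : ℕ × ℕ // q ∈ indexSet m}) (p : ℕ) :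
    PowerSeries.coeff p (coeffC F q.1) = PowerSeries.coeff (p + q.1.2) (coeffB F q) := by
  rw [coeffC, dif_pos q.2, PowerSeries.coeff_mk]

theorem coeffB_eq_X_pow_mul_coeffC {F : (Var m → ℂ) → ℂ} (hF : TotallyCharacteristic F)
    (q : {q : ℕ × ℕ // q ∈ indexSet m}) : coeffB F q = PowerSeries.X ^ q.1.2 * coeffC F q.1 := by
  obtain ⟨c, hc⟩ : (PowerSeries.X : PowerSeries ℂ) ^ q.1.2 ∣ coeffB F q := by
    rcases Nat.eq_zero_or_pos q.1.2 with h | h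
    · rw [h, pow_zero]; exact one_dvd _
    · exact hF q h
  rw [hc]
  congr 1
  ext p
  rw [coeff_coeffC, hc, PowerSeries.coeff_X_pow_mul]

/-- The contribution of the coefficient of `x^p` in `c_{j,α}(x)` to the coefficient of `t^k x^l`
in `c_{j,α}(x) x^α (t ∂_t)^j ∂_x^α u`. -/
def linTerm (F : (Var m → ℂ) → ℂ) (u : MvPowerSeries (Fin 2) ℂ) (k l : ℕ) (q : ℕ × ℕ) (p : ℕ) :
    ℂ :=
  PowerSeries.coeff p (coeffC F q) *
    ((k : ℂ) ^ q.1 * (((l - p).descFactorial q.2 : ℂ) * coeffTX u k (l - p)))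

theorem coeffTX_coeffB_subst_mul_jet {F : (Var m → ℂ) → ℂ} (hF : TotallyCharacteristic F)
    (u : MvPowerSeries (Fin 2) ℂ) (q : {q : ℕ × ℕ // q ∈ indexSet m}) (k l : ℕ) :
    coeffTX ((coeffB F q).subst (MvPowerSeries.X 1 : MvPowerSeries (Fin 2) ℂ) *
      jet m u (varZ q)) k l = ∑ p ∈ range (l + 1), linTerm F u k l q.1 p := by
  have hX : PowerSeries.HasSubst (MvPowerSeries.X 1 : MvPowerSeries (Fin 2) ℂ) :=
    PowerSeries.HasSubst.X 1
  rw [coeffB_eq_X_pow_mul_coeffC hF, PowerSeries.subst_mul hX, PowerSeries.subst_pow hX,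
    PowerSeries.subst_X hX, mul_comm (_ ^ _), mul_assoc, coeffTX_subst_X_one_mul,
    Finset.Nat.sum_antidiagonal_eq_sum_range_succ_mk]
  refine Finset.sum_congr rfl fun p _ => ?_
  rw [coeffTX_X_one_pow_mul, linTerm]
  split_ifs with h
  · rw [coeffTX_jet_varZ, Nat.sub_add_cancel h]
  · rw [Nat.descFactorial_of_lt (not_le.1 h)]; simp

theorem coeffTX_subst_jet {F : (Var m → ℂ) → ℂ} (hF : TotallyCharacteristic F)
    (h0 : ∀ l, MvPowerSeries.coeff (Finsupp.single (varX m) l) (taylorSeries F) = 0)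
    {u : MvPowerSeries (Fin 2) ℂ} (hu : ∀ l, coeffTX u 0 l = 0) (k l : ℕ) :
    coeffTX (MvPowerSeries.subst (jet m u) (taylorSeries F)) k l =
      (∑ q ∈ indexSet m, ∑ p ∈ range (l + 1), linTerm F u k l q p) + rest F u k l := by
  have hj := hasSubst_jet (m := m) hu
  have hlin (q : {q : ℕ × ℕ // q ∈ indexSet m}) : MvPowerSeries.subst (jet m u)
      ((coeffB F q).subst (MvPowerSeries.X (varX m) : MvPowerSeries (Var m) ℂ) *
        MvPowerSeries.X (varZ q)) =
      (coeffB F q).subst (MvPowerSeries.X 1 : MvPowerSeries (Fin 2) ℂ) * jet m u (varZ q) := by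
    rw [MvPowerSeries.subst_mul hj, MvPowerSeries.subst_X hj, PowerSeries.subst,
      MvPowerSeries.subst_comp_subst_apply (PowerSeries.HasSubst.X _).const hj, PowerSeries.subst]
    simp only [MvPowerSeries.subst_X hj, jet]
  conv_lhs => rw [taylorSeries_eq_sum_add_restPart h0]
  rw [MvPowerSeries.subst_add hj, ← MvPowerSeries.coe_substAlgHom hj, map_sum,
    MvPowerSeries.coe_substAlgHom hj, Finset.sum_congr rfl fun q _ => hlin q,
    ← coeffTX_subst_restPart F hu k l, ← Finset.sum_coe_sort (indexSet m)]
  simp only [coeffTX, map_add, map_sum, ← coeffTX_coeffB_subst_mul_jet hF]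

end Substitution

/-! ### Existence and uniqueness of the formal solution -/

theorem mk_span_X_zero_pow_eq_iff {N : ℕ} {f g : MvPowerSeries (Fin 2) ℂ} :
    Ideal.Quotient.mk (Ideal.span {MvPowerSeries.X 0 ^ N}) f =
        Ideal.Quotient.mk (Ideal.span {MvPowerSeries.X 0 ^ N}) g ↔
      ∀ k < N, ∀ l, coeffTX f k l = coeffTX g k l := by
  rw [Ideal.Quotient.eq, Ideal.mem_span_singleton, MvPowerSeries.X_pow_dvd_iff]
  constructor
  · intro h k hk l
    have := h (Finsupp.single 0 k + Finsupp.single 1 l) (by simpa using hk)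
    rwa [map_sub, sub_eq_zero] at this
  · intro h n hn
    rw [map_sub, sub_eq_zero, coeff_eq_coeffTX, coeff_eq_coeffTX, h _ hn]

theorem existsUnique_fixedPoint_of_causal {ι M : Type*} [LT ι] [WellFoundedLT ι] [Inhabited M]
    {T : (ι → M) → ι → M} (hT : ∀ f g i, (∀ j < i, f j = g j) → T f i = T g i) :
    ∃! f, T f = f := by
  classical
  refine existsUnique_of_exists_of_unique ?_ fun f g hf hg => funext fun i => ?_
  · let step (i : ι) (w : (j : ι) → j < i → M) : M :=
      T (fun j => if h : j < i then w j h else default) i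
    let f : ι → M := wellFounded_lt.fix step
    refine ⟨f, funext fun i => ?_⟩
    rw [show f i = step i fun j _ => f j from wellFounded_lt.fix_eq step i]
    exact hT _ _ i fun j hj => by rw [dif_pos hj]
  · induction i using WellFoundedLT.induction with
    | ind i ih => rw [← hf, ← hg]; exact hT f g i ih

theorem existsUnique_series_of_causal {T : MvPowerSeries (Fin 2) ℂ → ℕ → ℕ → ℂ}
    (hT : ∀ u v k l, (∀ i < k, ∀ j, coeffTX u i j = coeffTX v i j) →
      (∀ j < l, coeffTX u k j = coeffTX v k j) → T u k l = T v k l) :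
    ∃! u, ∀ k l, T u k l = coeffTX u k l := by
  let series (c : ℕ ×ₗ ℕ → ℂ) : MvPowerSeries (Fin 2) ℂ := ofCoeff fun k l => c (toLex (k, l))
  have hseries (c : ℕ ×ₗ ℕ → ℂ) (k l : ℕ) : coeffTX (series c) k l = c (toLex (k, l)) :=
    coeffTX_ofCoeff _ k l
  obtain ⟨c, hc, huniq⟩ := existsUnique_fixedPoint_of_causal
    (T := fun (c : ℕ ×ₗ ℕ → ℂ) i => T (series c) (ofLex i).1 (ofLex i).2) fun c d i h => by
      refine hT _ _ _ _ (fun k hk l => ?_) fun l hl => ?_ <;> rw [hseries, hseries]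
      · exact h _ (Prod.Lex.toLex_lt_toLex.2 (Or.inl hk))
      · exact h _ (Prod.Lex.toLex_lt_toLex.2 (Or.inr ⟨rfl, hl⟩))
  refine ⟨series c, fun k l => (congrFun hc _).trans (hseries c k l).symm, fun u hu => ?_⟩
  let d (i : ℕ ×ₗ ℕ) : ℂ := coeffTX u (ofLex i).1 (ofLex i).2
  have hd : series d = u := ext_coeffTX (hseries d)
  rw [← hd, huniq d (funext fun i => by simp only [hd, hu, d])]

section Recursion

variable {m : ℕ}

theorem rest_congr (F : (Var m → ℂ) → ℂ) {u v : MvPowerSeries (Fin 2) ℂ} {k : ℕ}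
    (h : ∀ i < k, ∀ j, coeffTX u i j = coeffTX v i j) (l : ℕ) : rest F u k l = rest F v k l := by
  refine Finset.sum_congr rfl fun n hn => ?_
  have hn : IsRest n := (mem_filter.1 hn).2
  rw [coeffTX_jetMonomial, coeffTX_jetMonomial]
  rcases Nat.eq_zero_or_pos (zDegree n) with hz | hz
  · rw [zMonomial_of_zDegree_eq_zero u hz, zMonomial_of_zDegree_eq_zero v hz]
  congr 1
  refine ite_congr rfl (fun hk => ite_congr rfl (fun _ => ?_) fun _ => rfl) fun _ => rfl
  refine mk_span_X_zero_pow_eq_iff.1 ?_ _ (?_ : _ < k - 1) _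
  swap
  · simp only [IsRest] at hn; omega
  simp only [zMonomial, map_prod, map_pow]
  refine Finset.prod_congr rfl fun q _ => congrArg (· ^ _) ?_
  refine mk_span_X_zero_pow_eq_iff.2 fun i hi j => ?_
  simp only [shiftT, coeffTX_ofCoeff, coeffTX_jet_varZ]
  rw [h _ (by omega)]

/-- The right-hand side of the recursion `L(k, l) u_{k,l} = …` for the coefficients of a formal
solution. -/
def recursionRHS (F : (Var m → ℂ) → ℂ) (u : MvPowerSeries (Fin 2) ℂ) (k l : ℕ) : ℂ :=
  (∑ q ∈ indexSet m, ∑ p ∈ Ico 1 (l + 1), linTerm F u k l q p) + rest F u k l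

theorem recursionRHS_congr (F : (Var m → ℂ) → ℂ) {u v : MvPowerSeries (Fin 2) ℂ} {k l : ℕ}
    (h : ∀ i < k, ∀ j, coeffTX u i j = coeffTX v i j)
    (h' : ∀ j < l, coeffTX u k j = coeffTX v k j) :
    recursionRHS F u k l = recursionRHS F v k l := by
  rw [recursionRHS, recursionRHS, rest_congr F h]
  congr 1
  refine Finset.sum_congr rfl fun q _ => Finset.sum_congr rfl fun p hp => ?_
  rw [mem_Ico] at hp
  rw [linTerm, linTerm, h' _ (by omega)]

theorem prod_range_sub_natCast (l a : ℕ) :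
    ∏ i ∈ range a, ((l : ℂ) - (i : ℂ)) = (l.descFactorial a : ℂ) := by
  rw [← descPochhammer_eval_eq_prod_range, descPochhammer_eval_eq_descFactorial]

theorem coeffTX_equation_iff {F : (Var m → ℂ) → ℂ} (hF : TotallyCharacteristic F)
    (h0 : ∀ l, MvPowerSeries.coeff (Finsupp.single (varX m) l) (taylorSeries F) = 0)
    {u : MvPowerSeries (Fin 2) ℂ} (hu : ∀ l, coeffTX u 0 l = 0) (k l : ℕ) :
    coeffTX (eulerT^[m] u) k l = coeffTX (MvPowerSeries.subst (jet m u) (taylorSeries F)) k l ↔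
      indicial F k l * coeffTX u k l = recursionRHS F u k l := by
  have hsum : ∀ q ∈ indexSet m, ∑ p ∈ range (l + 1), linTerm F u k l q p =
      coeffC0 F q * (k : ℂ) ^ q.1 * (∏ i ∈ range q.2, ((l : ℂ) - (i : ℂ))) * coeffTX u k l +
        ∑ p ∈ Ico 1 (l + 1), linTerm F u k l q p := fun q _ => by
    rw [Finset.range_eq_Ico, Finset.sum_eq_sum_Ico_succ_bot (by omega), prod_range_sub_natCast,
      linTerm, coeffC0, Nat.sub_zero, PowerSeries.coeff_zero_eq_constantCoeff]
    ring
  rw [coeffTX_subst_jet hF h0 hu, coeffTX_iterate_eulerT, recursionRHS, indicial,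
    Finset.sum_congr rfl hsum, Finset.sum_add_distrib, sub_mul, Finset.sum_mul,
    sub_eq_iff_eq_add', add_assoc]

theorem rest_zero {F : (Var m → ℂ) → ℂ} (u : MvPowerSeries (Fin 2) ℂ) (l : ℕ) :
    rest F u 0 l = 0 := by
  refine Finset.sum_eq_zero fun n hn => ?_
  have hn : IsRest n := (mem_filter.1 hn).2
  rw [coeffTX_jetMonomial, if_neg (by simp only [IsRest] at hn; omega), mul_zero]

theorem recursionRHS_zero {F : (Var m → ℂ) → ℂ} {u : MvPowerSeries (Fin 2) ℂ}
    (hu : ∀ l, coeffTX u 0 l = 0) (l : ℕ) : recursionRHS F u 0 l = 0 := by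
  simp [recursionRHS, rest_zero, linTerm, hu]

theorem isFormalSolution_iff {F : (Var m → ℂ) → ℂ} (hF : TotallyCharacteristic F)
    (h0 : ∀ l, MvPowerSeries.coeff (Finsupp.single (varX m) l) (taylorSeries F) = 0)
    (u : MvPowerSeries (Fin 2) ℂ) :
    IsFormalSolution F u ↔ (∀ l, coeffTX u 0 l = 0) ∧
      ∀ k l : ℕ, 1 ≤ k → indicial F k l * coeffTX u k l = recursionRHS F u k l := by
  constructor
  · intro hs
    have hu (l : ℕ) : coeffTX u 0 l = 0 := hs.zero_at_t_zero _ (by simp)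
    exact ⟨hu, fun k l _ => (coeffTX_equation_iff hF h0 hu k l).1 (by rw [hs.equation])⟩
  · rintro ⟨hu, h⟩
    refine ⟨fun n hn => by rw [coeff_eq_coeffTX, hn, hu], ext_coeffTX fun k l => ?_⟩
    refine (coeffTX_equation_iff hF h0 hu k l).2 ?_
    rcases Nat.eq_zero_or_pos k with rfl | hk
    · rw [hu, mul_zero, recursionRHS_zero hu]
    · exact h k l hk

theorem existsUnique_recursion {F : (Var m → ℂ) → ℂ} (hN : NonResonance F) :
    ∃! u : MvPowerSeries (Fin 2) ℂ, (∀ l, coeffTX u 0 l = 0) ∧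
      ∀ k l : ℕ, 1 ≤ k → indicial F k l * coeffTX u k l = recursionRHS F u k l := by
  have hiff (u : MvPowerSeries (Fin 2) ℂ) :
      (∀ k l, (if k = 0 then 0 else recursionRHS F u k l / indicial F k l) = coeffTX u k l) ↔
      (∀ l, coeffTX u 0 l = 0) ∧
        ∀ k l : ℕ, 1 ≤ k → indicial F k l * coeffTX u k l = recursionRHS F u k l := by
    refine ⟨fun h => ⟨fun l => by rw [← h, if_pos rfl], fun k l hk => ?_⟩, fun h k l => ?_⟩
    · rw [← h, if_neg (by omega), mul_div_cancel₀ _ (hN k l hk)]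
    · split_ifs with hk
      · rw [hk, h.1]
      · rw [div_eq_iff (hN k l (by omega)), mul_comm, h.2 k l (by omega)]
  simp only [← hiff]
  refine existsUnique_series_of_causal fun u v k l h h' => ?_
  rw [recursionRHS_congr F h h']

end Recursion

/-! ### The Newton polygon and the indicial polynomial -/

section NewtonPolygon

variable {m : ℕ} {F : (Var m → ℂ) → ℂ}

theorem coeffC0_top (F : (Var m → ℂ) → ℂ) : coeffC0 F (m, 0) = -1 := by
  rw [coeffC0, coeffC, dif_neg (by rw [mem_indexSet]; simp), if_pos rfl, map_neg, map_one]

theorem mem_lambda0 {q : ℕ × ℕ} :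
    q ∈ lambda0 F ↔ q = (m, 0) ∨ (q ∈ indexSet m ∧ coeffC0 F q ≠ 0) := by
  simp [lambda0]

theorem coeffC0_ne_zero {q : ℕ × ℕ} (hq : q ∈ lambda0 F) : coeffC0 F q ≠ 0 := by
  rcases mem_lambda0.1 hq with rfl | h
  · simp [coeffC0_top]
  · exact h.2

theorem top_mem_lambda0 (F : (Var m → ℂ) → ℂ) : (m, 0) ∈ lambda0 F :=
  mem_lambda0.2 (Or.inl rfl)

theorem add_le_of_mem_lambda0 {q : ℕ × ℕ} (hq : q ∈ lambda0 F) : q.1 + q.2 ≤ m := by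
  rcases mem_lambda0.1 hq with rfl | h
  · simp
  · exact (mem_indexSet.1 h.1).1

theorem indicial_eq_neg_sum (F : (Var m → ℂ) → ℂ) (k l : ℕ) :
    indicial F k l = -∑ q ∈ lambda0 F,
      coeffC0 F q * ((k : ℂ) ^ q.1 * (l.descFactorial q.2 : ℂ)) := by
  classical
  have htop : Disjoint {(m, 0)} ((indexSet m).filter fun q => coeffC0 F q ≠ 0) := by
    simp [mem_indexSet]
  have hterm : ∀ q ∈ indexSet m,
      coeffC0 F q * (k : ℂ) ^ q.1 * ∏ i ∈ range q.2, ((l : ℂ) - (i : ℂ)) =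
      if coeffC0 F q ≠ 0 then coeffC0 F q * ((k : ℂ) ^ q.1 * (l.descFactorial q.2 : ℂ))
      else 0 := fun q _ => by
    rw [prod_range_sub_natCast]
    split_ifs with h
    · ring
    · simp [not_not.1 h]
  rw [lambda0, Finset.sum_union htop, Finset.sum_singleton, coeffC0_top, Finset.sum_filter,
    indicial, Finset.sum_congr rfl hterm, Nat.descFactorial_zero]
  push_cast
  ring

theorem toPlane_injective : Function.Injective toPlane := fun q q' h => by
  simpa [toPlane, Prod.ext_iff] using h

theorem toPlane_mem_newtonPolygon {q : ℕ × ℕ} (hq : q ∈ lambda0 F) {P : ℝ × ℝ}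
    (hP : P ≤ toPlane q) : P ∈ newtonPolygon F :=
  subset_convexHull ℝ _ (Set.mem_biUnion hq hP)

theorem le_of_mem_newtonPolygon {a b c : ℝ} (ha : 0 ≤ a) (hb : 0 ≤ b)
    (h : ∀ q ∈ lambda0 F, a * q.1 + b * q.2 ≤ c) {P : ℝ × ℝ} (hP : P ∈ newtonPolygon F) :
    a * P.1 + b * P.2 ≤ c := by
  have hlin : IsLinearMap ℝ fun P : ℝ × ℝ => a * P.1 + b * P.2 :=
    ⟨fun x y => by simp only [Prod.fst_add, Prod.snd_add]; ring,
      fun t x => by simp only [Prod.smul_fst, Prod.smul_snd, smul_eq_mul]; ring⟩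
  refine convexHull_min (Set.iUnion₂_subset fun q hq P hP => ?_) (convex_halfSpace_le hlin c) hP
  calc a * P.1 + b * P.2 ≤ a * q.1 + b * q.2 := by gcongr <;> [exact hP.1; exact hP.2]
    _ ≤ c := h q hq

theorem mem_lambda0Face {s : ℝ} (hs : 0 ≤ s) {q : ℕ × ℕ} :
    q ∈ lambda0Face F s ↔ q ∈ lambda0 F ∧
      ∀ q' ∈ lambda0 F, s * q'.1 + q'.2 ≤ s * q.1 + q.2 := by
  classical
  rw [lambda0Face, mem_filter]
  refine and_congr_right fun hq => ⟨fun h q' hq' => ?_, fun h => ?_⟩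
  · exact h.2 (toPlane q') (toPlane_mem_newtonPolygon hq' le_rfl)
  · refine ⟨toPlane_mem_newtonPolygon hq le_rfl, fun Q hQ => ?_⟩
    simpa [toPlane] using
      le_of_mem_newtonPolygon (b := 1) (c := s * q.1 + q.2) hs zero_le_one (by simpa using h) hQ

theorem toPlane_mem_face {s : ℝ} {q : ℕ × ℕ} (hq : q ∈ lambda0Face F s) :
    toPlane q ∈ face F s := by
  classical
  exact (mem_filter.1 hq).2

/-- The sum `∑ c_{j,α}(0) x^j` over the points of `Λ₀` on the face of slope `-s`: up to a power
of `x`, the value at `x` of the characteristic polynomial on that face. -/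
def faceSum (F : (Var m → ℂ) → ℂ) (s x : ℝ) : ℂ :=
  ∑ q ∈ lambda0Face F s, coeffC0 F q * (x : ℂ) ^ q.1

theorem pow_leftEnd_mul_eval_charPoly (F : (Var m → ℂ) → ℂ) (s x : ℝ) :
    (x : ℂ) ^ leftEnd F s * (charPoly F s).eval (x : ℂ) = faceSum F s x := by
  rw [charPoly, Polynomial.eval_finsetSum, Finset.mul_sum, faceSum]
  refine Finset.sum_congr rfl fun q hq => ?_
  have hle : leftEnd F s ≤ q.1 := Nat.sInf_le ⟨q, hq, rfl⟩
  simp only [Polynomial.eval_mul, Polynomial.eval_C, Polynomial.eval_pow, Polynomial.eval_X]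
  rw [mul_left_comm, ← pow_add, Nat.add_sub_cancel' hle]

theorem faceSum_ne_zero (hGP : GeneralizedPoincare F) {s : ℝ} (hs : IsEdgeSlope F s) {x : ℝ}
    (hx : 0 < x) : faceSum F s x ≠ 0 := by
  rw [← pow_leftEnd_mul_eval_charPoly]
  exact mul_ne_zero (pow_ne_zero _ (Complex.ofReal_ne_zero.2 hx.ne'))
    fun h => hGP.edges s hs _ h ⟨x, hx.le, rfl⟩

theorem lambda0Face_zero_of_lastAbscissa_eq_zero (h : lastAbscissa F = 0) {q₀ : ℕ × ℕ}
    (hq₀ : q₀ ∈ lambda0Face F 0) : lambda0Face F 0 = {q₀} := by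
  have hfst : ∀ q ∈ lambda0Face F 0, q.1 = 0 := fun q hq =>
    Nat.le_zero.1 (h ▸ Finset.le_sup (f := fun q : ℕ × ℕ => q.1) hq)
  refine Finset.eq_singleton_iff_unique_mem.2 ⟨hq₀, fun q hq => ?_⟩
  have hq' := (mem_lambda0Face le_rfl).1 hq
  have hq₀' := (mem_lambda0Face le_rfl).1 hq₀
  have hge := hq'.2 _ hq₀'.1
  have hle := hq₀'.2 _ hq'.1
  simp only [zero_mul, zero_add, Nat.cast_le] at hge hle
  exact Prod.ext ((hfst q hq).trans (hfst q₀ hq₀).symm) (le_antisymm hle hge)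

theorem faceSum_zero_ne_zero (hGP : GeneralizedPoincare F) {k : ℕ} (hk : 1 ≤ k) {q₀ : ℕ × ℕ}
    (hq₀ : q₀ ∈ lambda0Face F 0) : faceSum F 0 k ≠ 0 := by
  rw [faceSum]
  by_cases hl : lastAbscissa F = 0
  · rw [lambda0Face_zero_of_lastAbscissa_eq_zero hl hq₀, Finset.sum_singleton]
    exact mul_ne_zero (coeffC0_ne_zero ((mem_lambda0Face le_rfl).1 hq₀).1)
      (pow_ne_zero _ (Complex.ofReal_ne_zero.2 (by positivity)))
  · refine fun h => hGP.last k ?_ ⟨k, hk, rfl⟩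
    rw [lastCharPoly, if_neg hl, Polynomial.IsRoot, Polynomial.eval_finsetSum, ← h]
    simp

end NewtonPolygon

/-! ### The lower bound for the indicial polynomial -/

section Monomials

theorem tendsto_log_natCast_atTop {ι : Type*} {U : Filter ι} {l : ι → ℕ}
    (hl : Tendsto l U atTop) : Tendsto (fun n => Real.log (l n)) U atTop :=
  Real.tendsto_log_atTop.comp (tendsto_natCast_atTop_atTop.comp hl)

theorem tendsto_descFactorial_div_pow (a : ℕ) :
    Tendsto (fun l : ℕ => (l.descFactorial a : ℝ) / (l : ℝ) ^ a) atTop (𝓝 1) := by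
  induction a with
  | zero => simp
  | succ a ih =>
    have hfactor : Tendsto (fun l : ℕ => 1 - (a : ℝ) / (l : ℝ)) atTop (𝓝 (1 - 0)) :=
      tendsto_const_nhds.sub (tendsto_const_div_atTop_nhds_zero_nat (a : ℝ))
    have hmul := hfactor.mul ih
    rw [sub_zero, mul_one] at hmul
    refine hmul.congr' ?_
    filter_upwards [eventually_gt_atTop a] with l hl
    have hl0 : (l : ℝ) ≠ 0 := Nat.cast_ne_zero.2 (by omega)
    rw [Nat.descFactorial_succ, Nat.cast_mul, Nat.cast_sub hl.le]
    field_simp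
    ring

/-- The monomial `k^j l^α`. -/
def mono (k l : ℕ) (q : ℕ × ℕ) : ℝ := (k : ℝ) ^ q.1 * (l : ℝ) ^ q.2

variable {k l : ℕ}

theorem mono_pos (hk : 1 ≤ k) (hl : 1 ≤ l) (q : ℕ × ℕ) : 0 < mono k l q := by
  unfold mono; positivity

theorem log_mono (hk : 1 ≤ k) (hl : 1 ≤ l) (q : ℕ × ℕ) :
    Real.log (mono k l q) = Real.log k * q.1 + Real.log l * q.2 := by
  rw [mono, Real.log_mul (by positivity) (by positivity), Real.log_pow, Real.log_pow, mul_comm,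
    mul_comm (q.2 : ℝ)]

theorem mono_div_mono_eq_exp (hk : 1 ≤ k) (hl : 1 ≤ l) (s : ℝ) (q q₀ : ℕ × ℕ) :
    mono k l q / mono k l q₀ =
      Real.exp (((q.1 : ℝ) - q₀.1) * (Real.log k - s * Real.log l) +
        ((s * q.1 + q.2) - (s * q₀.1 + q₀.2)) * Real.log l) := by
  rw [← Real.exp_log (mono_pos hk hl q), ← Real.exp_log (mono_pos hk hl q₀), ← Real.exp_sub,
    log_mono hk hl, log_mono hk hl]
  congr 1
  ring

end Monomials

section IndicialBound

variable {m : ℕ} {F : (Var m → ℂ) → ℂ} {k l : ℕ → ℕ} {q₀ : ℕ × ℕ}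

/-- Along the filter `U` the monomial of `q₀ ∈ Λ₀` dominates the monomials of `Λ₀`, but
`L(k, l)` is negligible against it. The lower bound for the indicial polynomial amounts to the
impossibility of this. -/
structure IsDegenerate (F : (Var m → ℂ) → ℂ) (U : Filter ℕ) (k l : ℕ → ℕ) (q₀ : ℕ × ℕ) :
    Prop where
  one_le_fst : ∀ n, 1 ≤ k n
  one_le_snd : ∀ n, 1 ≤ l n
  mem_lambda0 : q₀ ∈ lambda0 F
  mono_le : ∀ q ∈ lambda0 F, ∀ᶠ n in U, mono (k n) (l n) q ≤ mono (k n) (l n) q₀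
  tendsto_zero : Tendsto (fun n => indicial F (k n) (l n) / mono (k n) (l n) q₀) U (𝓝 0)

theorem indicial_div_mono {k l : ℕ} (hk : 1 ≤ k) (hl : 1 ≤ l) (q₀ : ℕ × ℕ) :
    indicial F k l / mono k l q₀ = -∑ q ∈ lambda0 F, coeffC0 F q *
      ((mono k l q / mono k l q₀ * (l.descFactorial q.2 / (l : ℝ) ^ q.2) : ℝ) : ℂ) := by
  have hl0 : (l : ℂ) ≠ 0 := by exact_mod_cast (Nat.one_le_iff_ne_zero.1 hl)
  have hmono : ((mono k l q₀ : ℝ) : ℂ) ≠ 0 := Complex.ofReal_ne_zero.2 (mono_pos hk hl q₀).ne'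
  rw [indicial_eq_neg_sum, neg_div, Finset.sum_div]
  congr 1
  refine Finset.sum_congr rfl fun q _ => ?_
  push_cast [mono] at hmono ⊢
  field_simp

namespace IsDegenerate

variable {U : Filter ℕ} [U.NeBot]

theorem sum_eq_zero (h : IsDegenerate F U k l q₀) (hl : Tendsto l U atTop) {X : ℕ × ℕ → ℝ}
    (hX : ∀ q ∈ lambda0 F,
      Tendsto (fun n => mono (k n) (l n) q / mono (k n) (l n) q₀) U (𝓝 (X q))) :
    ∑ q ∈ lambda0 F, coeffC0 F q * (X q : ℂ) = 0 := by
  have hterm : ∀ q ∈ lambda0 F, Tendsto (fun n => mono (k n) (l n) q / mono (k n) (l n) q₀ *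
      ((l n).descFactorial q.2 / (l n : ℝ) ^ q.2)) U (𝓝 (X q)) := fun q hq => by
    simpa using (hX q hq).mul ((tendsto_descFactorial_div_pow q.2).comp hl)
  have hsum : Tendsto (fun n => indicial F (k n) (l n) / mono (k n) (l n) q₀) U
      (𝓝 (-∑ q ∈ lambda0 F, coeffC0 F q * (X q : ℂ))) := by
    simp only [indicial_div_mono (h.one_le_fst _) (h.one_le_snd _)]
    exact (tendsto_finsetSum _ fun q hq => tendsto_const_nhds.mul
      ((Complex.continuous_ofReal.tendsto _).comp (hterm q hq))).neg
  exact neg_eq_zero.1 (tendsto_nhds_unique h.tendsto_zero hsum).symm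

section Slope

variable {s η : ℝ}

theorem mem_lambda0Face (h : IsDegenerate F U k l q₀) (hs : 0 ≤ s) (hl : Tendsto l U atTop)
    (hη : Tendsto (fun n => Real.log (k n) - s * Real.log (l n)) U (𝓝 η)) :
    q₀ ∈ lambda0Face F s := by
  refine (TotChar.mem_lambda0Face hs).2 ⟨h.mem_lambda0, fun q hq => ?_⟩
  by_contra! hlt
  have hratio : Tendsto (fun n => mono (k n) (l n) q / mono (k n) (l n) q₀) U atTop := by
    simp only [mono_div_mono_eq_exp (h.one_le_fst _) (h.one_le_snd _) s]
    exact Real.tendsto_exp_atTop.comp ((tendsto_const_nhds.mul hη).add_atTop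
      ((tendsto_log_natCast_atTop hl).const_mul_atTop (sub_pos.2 hlt)))
  obtain ⟨n, hn, hle⟩ := ((hratio.eventually_gt_atTop 1).and (h.mono_le q hq)).exists
  rw [one_lt_div (mono_pos (h.one_le_fst n) (h.one_le_snd n) q₀)] at hn
  exact hn.not_ge hle

theorem tendsto_ratio (h : IsDegenerate F U k l q₀) (hs : 0 ≤ s) (hl : Tendsto l U atTop)
    (hη : Tendsto (fun n => Real.log (k n) - s * Real.log (l n)) U (𝓝 η)) {q : ℕ × ℕ}
    (hq : q ∈ lambda0 F) [Decidable (q ∈ lambda0Face F s)] :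
    Tendsto (fun n => mono (k n) (l n) q / mono (k n) (l n) q₀) U
      (𝓝 (if q ∈ lambda0Face F s then Real.exp (((q.1 : ℝ) - q₀.1) * η) else 0)) := by
  have hq₀ := (TotChar.mem_lambda0Face hs).1 (h.mem_lambda0Face hs hl hη)
  simp only [mono_div_mono_eq_exp (h.one_le_fst _) (h.one_le_snd _) s]
  split_ifs with hface
  · have hslope : (s * q.1 + q.2) - (s * q₀.1 + q₀.2) = 0 :=
      sub_eq_zero.2 (le_antisymm (hq₀.2 q hq)
        (((TotChar.mem_lambda0Face hs).1 hface).2 q₀ h.mem_lambda0))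
    simp only [hslope, zero_mul, add_zero]
    exact (Real.continuous_exp.tendsto _).comp (tendsto_const_nhds.mul hη)
  · have hslope : (s * q.1 + q.2) - (s * q₀.1 + q₀.2) < 0 := by
      by_contra! hge
      exact hface ((TotChar.mem_lambda0Face hs).2
        ⟨hq, fun q' hq' => (hq₀.2 q' hq').trans (sub_nonneg.1 hge)⟩)
    exact Real.tendsto_exp_atBot.comp ((tendsto_const_nhds.mul hη).add_atBot
      ((tendsto_log_natCast_atTop hl).const_mul_atTop_of_neg hslope))

theorem faceSum_eq_zero (h : IsDegenerate F U k l q₀) (hs : 0 ≤ s) (hl : Tendsto l U atTop)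
    (hη : Tendsto (fun n => Real.log (k n) - s * Real.log (l n)) U (𝓝 η)) :
    faceSum F s (Real.exp η) = 0 := by
  classical
  have hsum := h.sum_eq_zero hl fun q hq => h.tendsto_ratio hs hl hη hq
  have hsub : (lambda0 F).filter (fun q => q ∈ lambda0Face F s) = lambda0Face F s := by
    ext q
    rw [mem_filter, and_iff_right_of_imp fun hq => ((TotChar.mem_lambda0Face hs).1 hq).1]
  simp only [apply_ite Complex.ofReal, Complex.ofReal_zero, mul_ite, mul_zero] at hsum
  rw [← Finset.sum_filter, hsub] at hsum
  rw [faceSum, ← mul_zero ((Real.exp (q₀.1 * η) : ℝ) : ℂ), ← hsum, Finset.mul_sum]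
  refine Finset.sum_congr rfl fun q _ => ?_
  rw [mul_left_comm, ← Complex.ofReal_mul, ← Real.exp_add, ← Complex.ofReal_pow,
    ← Real.exp_nat_mul]
  congr 3
  ring

end Slope

theorem not_eventually_fst_eq (h : IsDegenerate F U k l q₀) (hGP : GeneralizedPoincare F)
    (hl : Tendsto l U atTop) (k₀ : ℕ) : ¬ ∀ᶠ n in U, k n = k₀ := by
  intro hk
  obtain ⟨n, hn⟩ := hk.exists
  have hk₀ : 1 ≤ k₀ := hn ▸ h.one_le_fst n
  have hη : Tendsto (fun n => Real.log (k n) - 0 * Real.log (l n)) U (𝓝 (Real.log k₀)) := by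
    refine tendsto_const_nhds.congr' ?_
    filter_upwards [hk] with n hn
    rw [hn, zero_mul, sub_zero]
  refine faceSum_zero_ne_zero hGP hk₀ (h.mem_lambda0Face le_rfl hl hη) ?_
  rw [← Real.exp_log (show (0 : ℝ) < k₀ by positivity)]
  exact h.faceSum_eq_zero le_rfl hl hη

theorem exists_slope (h : IsDegenerate F U k l q₀) (hk : Tendsto k U atTop)
    (hl : Tendsto l U atTop) {q₁ : ℕ × ℕ} (hne : q₁ ≠ q₀) {X : ℝ} (hX : X ≠ 0)
    (hratio : Tendsto (fun n => mono (k n) (l n) q₁ / mono (k n) (l n) q₀) U (𝓝 X)) :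
    ∃ s η : ℝ, 0 < s ∧ Tendsto (fun n => Real.log (k n) - s * Real.log (l n)) U (𝓝 η) := by
  set a : ℝ := (q₁.1 : ℝ) - q₀.1
  set b : ℝ := (q₁.2 : ℝ) - q₀.2
  have hlog : Tendsto (fun n => a * Real.log (k n) + b * Real.log (l n)) U
      (𝓝 (Real.log X)) := by
    refine (hratio.log hX).congr fun n => ?_
    rw [mono_div_mono_eq_exp (h.one_le_fst n) (h.one_le_snd n) 0, Real.log_exp]
    ring
  have ha0 : a ≠ 0 := by
    intro ha0
    have hb0 : b ≠ 0 := fun hb0 =>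
      hne (Prod.ext (by exact_mod_cast sub_eq_zero.1 ha0) (by exact_mod_cast sub_eq_zero.1 hb0))
    refine not_tendsto_nhds_of_tendsto_atTop (tendsto_log_natCast_atTop hl) _
      ((hlog.const_mul b⁻¹).congr fun n => ?_)
    rw [ha0, zero_mul, zero_add, inv_mul_cancel_left₀ hb0]
  have hη : Tendsto (fun n => Real.log (k n) - (-b / a) * Real.log (l n)) U
      (𝓝 (a⁻¹ * Real.log X)) := by
    refine (hlog.const_mul a⁻¹).congr fun n => ?_
    field_simp
    ring
  refine ⟨-b / a, _, ?_, hη⟩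
  by_contra! hs
  refine not_tendsto_nhds_of_tendsto_atTop
    (tendsto_atTop_mono (fun n => ?_) (tendsto_log_natCast_atTop hk)) _ hη
  nlinarith [Real.log_natCast_nonneg (l n)]

end IsDegenerate

theorem eventually_const_or_tendsto_atTop {ι : Type*} (U : Ultrafilter ι) (k : ι → ℕ) :
    (∃ k₀, ∀ᶠ n in U, k n = k₀) ∨ Tendsto k U atTop := by
  refine or_iff_not_imp_right.2 fun h => ?_
  rw [tendsto_atTop] at h
  push Not at h
  obtain ⟨b, hb⟩ := h
  have hbdd : ∀ᶠ n in U, ∃ a ∈ Set.Iio b, k n = a := by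
    filter_upwards [hb] with n hn
    exact ⟨k n, hn, rfl⟩
  obtain ⟨a, -, ha⟩ := (Ultrafilter.eventually_exists_mem_iff (Set.finite_Iio b)).1 hbdd
  exact ⟨a, ha⟩

theorem tendsto_indicial_div_pow (F : (Var m → ℂ) → ℂ) (l : ℕ) :
    Tendsto (fun k : ℕ => indicial F k l / (k : ℂ) ^ m) atTop (𝓝 1) := by
  have hterm : ∀ q ∈ indexSet m,
      Tendsto (fun k : ℕ => (((k : ℝ) ^ q.1 / (k : ℝ) ^ m : ℝ) : ℂ)) atTop (𝓝 (0 : ℝ)) :=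
    fun q hq => (Complex.continuous_ofReal.tendsto _).comp
      ((tendsto_pow_div_pow_atTop_zero (mem_indexSet.1 hq).2).comp tendsto_natCast_atTop_atTop)
  have hlim : Tendsto (fun k : ℕ => (1 : ℂ) - ∑ q ∈ indexSet m, coeffC0 F q *
      (((k : ℝ) ^ q.1 / (k : ℝ) ^ m : ℝ) : ℂ) * ∏ i ∈ range q.2, ((l : ℂ) - (i : ℂ))) atTop
      (𝓝 (1 - ∑ q ∈ indexSet m, coeffC0 F q * ((0 : ℝ) : ℂ) *
        ∏ i ∈ range q.2, ((l : ℂ) - (i : ℂ)))) :=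
    tendsto_const_nhds.sub (tendsto_finsetSum _ fun q hq =>
      (tendsto_const_nhds.mul (hterm q hq)).mul_const _)
  simp only [Complex.ofReal_zero, mul_zero, zero_mul, Finset.sum_const_zero, sub_zero] at hlim
  refine hlim.congr' ?_
  filter_upwards [eventually_ge_atTop 1] with k hk
  have hk0 : (k : ℂ) ≠ 0 := Nat.cast_ne_zero.2 (by omega)
  rw [indicial, sub_div, div_self (pow_ne_zero _ hk0), Finset.sum_div]
  congr 1
  refine Finset.sum_congr rfl fun q _ => ?_
  push_cast
  field_simp

theorem exists_pow_le_norm_indicial_of_snd (hN : NonResonance F) (l : ℕ) :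
    ∃ C : ℝ, ∀ k : ℕ, 1 ≤ k → (k : ℝ) ^ m ≤ C * ‖indicial F k l‖ := by
  obtain ⟨C, hC⟩ := ((tendsto_indicial_div_pow F l).norm.inv₀ (by simp)).bddAbove_range
  refine ⟨C, fun k hk => ?_⟩
  have hle := hC ⟨k, rfl⟩
  simpa only [norm_div, norm_pow, Complex.norm_natCast, inv_div,
    div_le_iff₀ (norm_pos_iff.2 (hN k l hk))] using hle

namespace IsDegenerate

theorem not_eventually_snd_eq {U : Filter ℕ} [U.NeBot] (h : IsDegenerate F U k l q₀)
    (hN : NonResonance F) (l₀ : ℕ) : ¬ ∀ᶠ n in U, l n = l₀ := by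
  intro hl
  obtain ⟨C, hC⟩ := exists_pow_le_norm_indicial_of_snd hN l₀
  have hone : ∀ᶠ n in U,
      1 ≤ C * (l₀ : ℝ) ^ q₀.2 * ‖indicial F (k n) (l n) / mono (k n) (l n) q₀‖ := by
    filter_upwards [hl] with n hn
    have hk := h.one_le_fst n
    have hpos := mono_pos hk (h.one_le_snd n) q₀
    rw [hn] at hpos ⊢
    rw [norm_div, Complex.norm_of_nonneg hpos.le, ← mul_div_assoc, one_le_div hpos]
    calc mono (k n) l₀ q₀ ≤ (k n : ℝ) ^ m * (l₀ : ℝ) ^ q₀.2 := by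
          have : q₀.1 ≤ m := le_of_add_le_left (add_le_of_mem_lambda0 h.mem_lambda0)
          unfold mono
          gcongr
          exact_mod_cast hk
      _ ≤ C * ‖indicial F (k n) l₀‖ * (l₀ : ℝ) ^ q₀.2 := by gcongr; exact hC _ hk
      _ = C * (l₀ : ℝ) ^ q₀.2 * ‖indicial F (k n) l₀‖ := by ring
  have hzero := h.tendsto_zero.norm.const_mul (C * (l₀ : ℝ) ^ q₀.2)
  rw [norm_zero, mul_zero] at hzero
  exact zero_lt_one.not_ge (ge_of_tendsto hzero hone)

variable {U : Ultrafilter ℕ}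

theorem exists_tendsto_ratio (h : IsDegenerate F U k l q₀) {q : ℕ × ℕ} (hq : q ∈ lambda0 F) :
    ∃ X : ℝ, Tendsto (fun n => mono (k n) (l n) q / mono (k n) (l n) q₀) U (𝓝 X) := by
  obtain ⟨X, -, hX⟩ := (isCompact_Icc (a := (0 : ℝ)) (b := 1)).ultrafilter_le_nhds
    (U.map fun n => mono (k n) (l n) q / mono (k n) (l n) q₀) (by
      rw [le_principal_iff, Ultrafilter.mem_coe, Ultrafilter.mem_map]
      filter_upwards [h.mono_le q hq] with n hn
      have hpos := mono_pos (h.one_le_fst n) (h.one_le_snd n)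
      exact ⟨(div_pos (hpos q) (hpos q₀)).le, (div_le_one (hpos q₀)).2 hn⟩)
  exact ⟨X, hX⟩

theorem exists_ne_of_tendsto (h : IsDegenerate F U k l q₀) (hl : Tendsto l U atTop) :
    ∃ q₁ ∈ lambda0 F, q₁ ≠ q₀ ∧ ∃ X : ℝ, X ≠ 0 ∧
      Tendsto (fun n => mono (k n) (l n) q₁ / mono (k n) (l n) q₀) U (𝓝 X) := by
  choose! X hX using fun q => h.exists_tendsto_ratio (q := q)
  by_contra! hcon
  have hzero : ∀ q ∈ lambda0 F, q ≠ q₀ → X q = 0 := fun q hq hne => by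
    by_contra hXq
    exact hcon q hq hne (X q) hXq (hX q hq)
  have hone : X q₀ = 1 := by
    refine tendsto_nhds_unique (hX q₀ h.mem_lambda0) (tendsto_const_nhds.congr fun n => ?_)
    rw [div_self (mono_pos (h.one_le_fst n) (h.one_le_snd n) q₀).ne']
  have hsum := h.sum_eq_zero hl hX
  rw [Finset.sum_eq_single_of_mem q₀ h.mem_lambda0
    fun q hq hne => by rw [hzero q hq hne, Complex.ofReal_zero, mul_zero], hone,
    Complex.ofReal_one, mul_one] at hsum
  exact coeffC0_ne_zero h.mem_lambda0 hsum

theorem elim (h : IsDegenerate F U k l q₀) (hN : NonResonance F)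
    (hGP : GeneralizedPoincare F) : False := by
  classical
  rcases eventually_const_or_tendsto_atTop U l with ⟨l₀, hl₀⟩ | hl
  · exact h.not_eventually_snd_eq hN l₀ hl₀
  rcases eventually_const_or_tendsto_atTop U k with ⟨k₀, hk₀⟩ | hk
  · exact h.not_eventually_fst_eq hGP hl k₀ hk₀
  obtain ⟨q₁, hq₁, hne, X, hX, hratio⟩ := h.exists_ne_of_tendsto hl
  obtain ⟨s, η, hs, hη⟩ := h.exists_slope hk hl hne hX hratio
  have hface₁ : q₁ ∈ lambda0Face F s := by
    by_contra hq₁'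
    have hlim := h.tendsto_ratio hs.le hl hη hq₁
    rw [if_neg hq₁'] at hlim
    exact hX (tendsto_nhds_unique hratio hlim)
  have hedge : IsEdgeSlope F s := ⟨hs, toPlane q₁, toPlane_mem_face hface₁, toPlane q₀,
    toPlane_mem_face (h.mem_lambda0Face hs.le hl hη), toPlane_injective.ne hne⟩
  exact faceSum_ne_zero hGP hedge (Real.exp_pos η) (h.faceSum_eq_zero hs.le hl hη)

end IsDegenerate

theorem exists_isDegenerate (h : ∀ C : ℝ, 0 < C → ∃ k l : ℕ, 1 ≤ k ∧ 1 ≤ l ∧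
      ∃ q ∈ lambda0 F, C * ‖indicial F k l‖ < mono k l q) :
    ∃ (k l : ℕ → ℕ) (q₀ : ℕ × ℕ), IsDegenerate F (hyperfilter ℕ) k l q₀ := by
  have hseq : ∀ n : ℕ, ∃ k l : ℕ, 1 ≤ k ∧ 1 ≤ l ∧ ∃ q₀ ∈ lambda0 F,
      (∀ q ∈ lambda0 F, mono k l q ≤ mono k l q₀) ∧
      ((n : ℝ) + 1) * ‖indicial F k l‖ < mono k l q₀ := by
    intro n
    obtain ⟨k, l, hk, hl, q, hq, hlt⟩ := h ((n : ℝ) + 1) (by positivity)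
    obtain ⟨q₀, hq₀, hmax⟩ := (lambda0 F).exists_max_image (mono k l) ⟨q, hq⟩
    exact ⟨k, l, hk, hl, q₀, hq₀, hmax, hlt.trans_le (hmax q hq)⟩
  choose k l hk hl p hp hmax hlt using hseq
  obtain ⟨q₀, hq₀, hpq⟩ := (Ultrafilter.eventually_exists_mem_iff (f := hyperfilter ℕ)
    (P := fun a n => p n = a) (lambda0 F).finite_toSet).1
    (Eventually.of_forall fun n => ⟨p n, hp n, rfl⟩)
  refine ⟨k, l, q₀, hk, hl, hq₀, fun q hq => ?_, ?_⟩
  · filter_upwards [hpq] with n hn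
    exact hn ▸ hmax n q hq
  · refine squeeze_zero_norm' ?_
      (tendsto_one_div_add_atTop_nhds_zero_nat.mono_left Nat.hyperfilter_le_atTop)
    filter_upwards [hpq] with n hn
    have hpos := mono_pos (hk n) (hl n) q₀
    rw [norm_div, Complex.norm_of_nonneg hpos.le, div_le_div_iff₀ hpos (by positivity), one_mul,
      mul_comm]
    exact (hn ▸ hlt n).le

theorem exists_mono_le_norm_indicial (hN : NonResonance F) (hGP : GeneralizedPoincare F) :
    ∃ C : ℝ, 0 < C ∧ ∀ k l : ℕ, 1 ≤ k → 1 ≤ l → ∀ q ∈ lambda0 F,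
      mono k l q ≤ C * ‖indicial F k l‖ := by
  by_contra! h
  obtain ⟨k, l, q₀, hdeg⟩ := exists_isDegenerate h
  exact hdeg.elim hN hGP

theorem exists_pow_le_norm_indicial (hN : NonResonance F) (hGP : GeneralizedPoincare F) :
    ∃ C : ℝ, 0 < C ∧ (∀ k l : ℕ, 1 ≤ k → (k : ℝ) ^ m ≤ C * ‖indicial F k l‖) ∧
      ∀ k l : ℕ, 1 ≤ k → 1 ≤ l → ∀ q ∈ lambda0 F, mono k l q ≤ C * ‖indicial F k l‖ := by
  obtain ⟨C, hC, hmono⟩ := exists_mono_le_norm_indicial hN hGP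
  obtain ⟨C', hC'⟩ := exists_pow_le_norm_indicial_of_snd hN 0
  have hmono' : ∀ k l : ℕ, 1 ≤ k → 1 ≤ l → ∀ q ∈ lambda0 F,
      mono k l q ≤ max C C' * ‖indicial F k l‖ := fun k l hk hl q hq =>
    (hmono k l hk hl q hq).trans (by gcongr; exact le_max_left _ _)
  refine ⟨max C C', lt_max_of_lt_left hC, fun k l hk => ?_, hmono'⟩
  rcases Nat.eq_zero_or_pos l with rfl | hl
  · exact (hC' k hk).trans (by gcongr; exact le_max_right _ _)
  · simpa [mono] using hmono' k l hk hl _ (top_mem_lambda0 F)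

end IndicialBound

section PolygonBound

variable {m : ℕ} {F : (Var m → ℂ) → ℂ} {B : ℝ} {k l : ℕ}

theorem rpow_le_of_mono_le (hk : 1 ≤ k) (hl : 1 ≤ l) (h : ∀ q ∈ lambda0 F, mono k l q ≤ B)
    {P : ℝ × ℝ} (hP : P ∈ newtonPolygon F) : (k : ℝ) ^ P.1 * (l : ℝ) ^ P.2 ≤ B := by
  have hB : 0 < B := (mono_pos hk hl _).trans_le (h _ (top_mem_lambda0 F))
  rw [Real.rpow_def_of_pos (by positivity), Real.rpow_def_of_pos (by positivity), ← Real.exp_add,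
    ← Real.le_log_iff_exp_le hB]
  exact le_of_mem_newtonPolygon (Real.log_natCast_nonneg k) (Real.log_natCast_nonneg l)
    (fun q hq => log_mono hk hl q ▸ Real.log_le_log (mono_pos hk hl q) (h q hq)) hP

theorem mono_le_rpow_excess (hk : 1 ≤ k) (hl : 1 ≤ l) (h : ∀ q ∈ lambda0 F, mono k l q ≤ B)
    {q : ℕ × ℕ} (hq : q ∈ indexSet m) : mono k l q ≤ B * (l : ℝ) ^ excess F q := by
  have hl0 : (0 : ℝ) < l := by positivity
  have hbdd : BddBelow {y : ℝ | ((q.1 : ℝ), (q.2 : ℝ) - y) ∈ newtonPolygon F} := by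
    refine ⟨(q.2 : ℝ) - m, fun y hy => ?_⟩
    have hle := le_of_mem_newtonPolygon (a := 0) (b := 1) (c := m) le_rfl zero_le_one
      (fun q' hq' => by
        rw [zero_mul, zero_add, one_mul]
        exact_mod_cast le_of_add_le_right (add_le_of_mem_lambda0 hq')) hy
    linarith
  have hne : {y : ℝ | ((q.1 : ℝ), (q.2 : ℝ) - y) ∈ newtonPolygon F}.Nonempty :=
    ⟨q.2, toPlane_mem_newtonPolygon (top_mem_lambda0 F)
      ⟨Nat.cast_le.2 (mem_indexSet.1 hq).2.le, by simp [toPlane]⟩⟩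
  have hclosed : IsClosed {y : ℝ | mono k l q ≤ B * (l : ℝ) ^ y} :=
    isClosed_le continuous_const
      (continuous_const.mul (Real.continuous_const_rpow hl0.ne'))
  refine closure_minimal (fun y hy => ?_) hclosed (csInf_mem_closure hne hbdd)
  have hle := rpow_le_of_mono_le hk hl h hy
  rw [Real.rpow_natCast, Real.rpow_sub hl0, Real.rpow_natCast, ← mul_div_assoc,
    div_le_iff₀ (by positivity)] at hle
  exact hle

end PolygonBound

/-! ### The irregularity -/

section Irregularity

variable {m : ℕ} {F : (Var m → ℂ) → ℂ}

theorem bddAbove_irregularity (F : (Var m → ℂ) → ℂ) :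
    BddAbove (insert 1 ((fun q => ((zeroOrder F q : ℝ) + excess F q) / (zeroOrder F q : ℝ)) ''
      lambda1 F)) := by
  have hfin : (lambda1 F).Finite := (indexSet m).finite_toSet.subset fun q hq => hq.1
  exact ((hfin.image _).insert 1).bddAbove

theorem one_le_irregularity (F : (Var m → ℂ) → ℂ) : 1 ≤ irregularity F :=
  le_csSup (bddAbove_irregularity F) (Set.mem_insert _ _)

theorem natCast_zeroOrder {q : ℕ × ℕ} (hq : q ∈ lambda1 F) :
    (zeroOrder F q : ℕ∞) = (coeffC F q).order :=
  ENat.natCast_toNat fun h => hq.2.2 (PowerSeries.order_eq_top.1 h)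

theorem one_le_zeroOrder {q : ℕ × ℕ} (hq : q ∈ lambda1 F) : 1 ≤ zeroOrder F q := by
  rw [← Nat.cast_le (α := ℕ∞), natCast_zeroOrder hq, Nat.cast_one, Order.one_le_iff_ne_zero]
  intro h
  have hcoeff := PowerSeries.coeff_order hq.2.2
  rw [h] at hcoeff
  exact hcoeff (by simpa [coeffC0] using hq.2.1)

theorem zeroOrder_le {q : ℕ × ℕ} (hq : q ∈ lambda1 F) {p : ℕ}
    (hp : PowerSeries.coeff p (coeffC F q) ≠ 0) : zeroOrder F q ≤ p := by
  rw [← Nat.cast_le (α := ℕ∞), natCast_zeroOrder hq]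
  exact PowerSeries.order_le p hp

theorem excess_le {q : ℕ × ℕ} (hq : q ∈ lambda1 F) :
    excess F q ≤ zeroOrder F q * (irregularity F - 1) := by
  have hle : ((zeroOrder F q : ℝ) + excess F q) / (zeroOrder F q : ℝ) ≤ irregularity F :=
    le_csSup (bddAbove_irregularity F) (Set.mem_insert_of_mem _ ⟨q, hq, rfl⟩)
  rw [div_le_iff₀ (by exact_mod_cast one_le_zeroOrder hq)] at hle
  linarith

theorem pow_le_factorial_mul_descFactorial {r l : ℕ} (h : r ≤ l) :
    l ^ r ≤ r ! * l.descFactorial r := by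
  induction r with
  | zero => simp
  | succ r ih =>
    have hl : l ≤ (r + 1) * (l - r) := by
      obtain ⟨d, rfl⟩ := Nat.exists_eq_add_of_le h
      rw [show r + 1 + d - r = d + 1 by omega]
      nlinarith
    calc l ^ (r + 1) = l * l ^ r := pow_succ' l r
      _ ≤ ((r + 1) * (l - r)) * (r ! * l.descFactorial r) := Nat.mul_le_mul hl (ih (by omega))
      _ = (r + 1)! * l.descFactorial (r + 1) := by
        rw [Nat.factorial_succ, Nat.descFactorial_succ]; ring

theorem descFactorial_le_descFactorial {l r p : ℕ} (hrp : r ≤ p) (hpl : p ≤ l) :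
    l.descFactorial r ≤ l.descFactorial p := by
  rw [← Nat.descFactorial_mul_descFactorial hrp]
  exact Nat.le_mul_of_pos_left _ (Nat.descFactorial_pos.2 (by omega))

theorem rpow_excess_le {q : ℕ × ℕ} (hq : q ∈ lambda1 F) {p l : ℕ} (hl : 1 ≤ l) (hpl : p ≤ l)
    (hp : PowerSeries.coeff p (coeffC F q) ≠ 0) :
    (l : ℝ) ^ excess F q ≤
      ((zeroOrder F q)! * l.descFactorial p : ℝ) ^ (irregularity F - 1) := by
  have hzp := zeroOrder_le hq hp
  have hpow : l ^ zeroOrder F q ≤ (zeroOrder F q)! * l.descFactorial p :=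
    (pow_le_factorial_mul_descFactorial (hzp.trans hpl)).trans
      (Nat.mul_le_mul_left _ (descFactorial_le_descFactorial hzp hpl))
  calc (l : ℝ) ^ excess F q ≤ (l : ℝ) ^ ((zeroOrder F q : ℝ) * (irregularity F - 1)) :=
        Real.rpow_le_rpow_of_exponent_le (by exact_mod_cast hl) (excess_le hq)
    _ = ((l : ℝ) ^ zeroOrder F q) ^ (irregularity F - 1) := by
        rw [Real.rpow_mul (by positivity), Real.rpow_natCast]
    _ ≤ _ := Real.rpow_le_rpow (by positivity) (by exact_mod_cast hpow)
        (sub_nonneg.2 (one_le_irregularity F))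

theorem mono_le_of_coeff_ne_zero {B : ℝ} {k l p : ℕ} (hk : 1 ≤ k) (hl : 1 ≤ l) (hpl : p ≤ l)
    (h : ∀ q ∈ lambda0 F, mono k l q ≤ B) {q : ℕ × ℕ} (hq : q ∈ indexSet m)
    (hp : PowerSeries.coeff p (coeffC F q) ≠ 0) :
    mono k l q ≤ B * ((zeroOrder F q)! * l.descFactorial p : ℝ) ^ (irregularity F - 1) := by
  have hB : 0 ≤ B := (mono_pos hk hl _).le.trans (h _ (top_mem_lambda0 F))
  by_cases hc0 : coeffC0 F q = 0
  · have hq₁ : q ∈ lambda1 F := ⟨hq, hc0, fun h => hp (by rw [h, map_zero])⟩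
    refine (mono_le_rpow_excess hk hl h hq).trans ?_
    gcongr
    exact rpow_excess_le hq₁ hl hpl hp
  · refine (h q (mem_lambda0.2 (Or.inr ⟨hq, hc0⟩))).trans (le_mul_of_one_le_right hB
      (Real.one_le_rpow ?_ (sub_nonneg.2 (one_le_irregularity F))))
    exact_mod_cast Nat.mul_pos (Nat.factorial_pos _) (Nat.descFactorial_pos.2 hpl)

theorem exists_mono_le_indicial_mul (hN : NonResonance F) (hGP : GeneralizedPoincare F) :
    ∃ C : ℝ, 0 < C ∧ (∀ k l : ℕ, 1 ≤ k → (k : ℝ) ^ m ≤ C * ‖indicial F k l‖) ∧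
      ∀ q ∈ indexSet m, ∀ k l p : ℕ, 1 ≤ k → 1 ≤ l → p ≤ l →
        PowerSeries.coeff p (coeffC F q) ≠ 0 →
        mono k l q ≤ C * ‖indicial F k l‖ *
          (l.descFactorial p : ℝ) ^ (irregularity F - 1) := by
  obtain ⟨C, hC, hpow, hmono⟩ := exists_pow_le_norm_indicial hN hGP
  set Z : ℕ × ℕ → ℝ := fun q => ((zeroOrder F q)! : ℝ) ^ (irregularity F - 1)
  have hZ : ∀ q, 0 ≤ Z q := fun q => by positivity
  have hsum : 0 ≤ ∑ q ∈ indexSet m, Z q := Finset.sum_nonneg fun q _ => hZ q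
  refine ⟨C * (1 + ∑ q ∈ indexSet m, Z q), by positivity, fun k l hk => ?_,
    fun q hq k l p hk hl hpl hp => ?_⟩
  · refine (hpow k l hk).trans ?_
    gcongr
    exact le_mul_of_one_le_right hC.le (by linarith)
  · have hZq : Z q ≤ 1 + ∑ q ∈ indexSet m, Z q := by
      linarith [Finset.single_le_sum (fun q _ => hZ q) hq]
    calc mono k l q ≤ C * ‖indicial F k l‖ *
          ((zeroOrder F q)! * l.descFactorial p : ℝ) ^ (irregularity F - 1) :=
          mono_le_of_coeff_ne_zero hk hl hpl (hmono k l hk hl) hq hp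
      _ = C * Z q * ‖indicial F k l‖ * (l.descFactorial p : ℝ) ^ (irregularity F - 1) := by
          rw [Real.mul_rpow (by positivity) (by positivity)]; ring
      _ ≤ _ := by gcongr

end Irregularity

/-! ### Gevrey majorants -/

section Theta

variable {σ : ℝ}

/-- The coefficient of `x^l` in the majorant `∑ (a (a + 1) ⋯ (a + l - 1))^σ / l! x^l`, which
for `σ = 1` is the expansion of `(1 - x)^{-a}` and in general has Gevrey order `σ`. -/
def theta (σ : ℝ) (a l : ℕ) : ℝ := (a.ascFactorial l : ℝ) ^ σ / (l ! : ℝ)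

theorem theta_nonneg (σ : ℝ) (a l : ℕ) : 0 ≤ theta σ a l := by unfold theta; positivity

theorem factorial_le_ascFactorial {a : ℕ} (ha : 1 ≤ a) (l : ℕ) : l ! ≤ a.ascFactorial l := by
  rw [← Nat.one_ascFactorial]; exact Nat.ascFactorial_le l ha

theorem one_le_theta (hσ : 1 ≤ σ) {a : ℕ} (ha : 1 ≤ a) (l : ℕ) : 1 ≤ theta σ a l := by
  have hfac : (1 : ℝ) ≤ l ! := by exact_mod_cast Nat.factorial_pos l
  have hasc : (l ! : ℝ) ≤ a.ascFactorial l := by exact_mod_cast factorial_le_ascFactorial ha l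
  rw [theta, le_div_iff₀ (by positivity), one_mul]
  exact hasc.trans (Real.self_le_rpow_of_one_le (hfac.trans hasc) hσ)

theorem theta_mono_left (hσ : 0 ≤ σ) {a b : ℕ} (h : a ≤ b) (l : ℕ) :
    theta σ a l ≤ theta σ b l := by
  unfold theta
  gcongr

theorem theta_mul_descFactorial_le (hσ : 0 ≤ σ) {a : ℕ} (ha : 1 ≤ a) {p l : ℕ} (hp : p ≤ l) :
    theta σ a (l - p) * (l.descFactorial p : ℝ) ^ (σ - 1) ≤ theta σ a l := by
  obtain ⟨d, rfl⟩ := Nat.exists_eq_add_of_le' hp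
  have hdesc : (0 : ℝ) < (d + p).descFactorial p := by
    exact_mod_cast Nat.descFactorial_pos.2 (Nat.le_add_left p d)
  have hfac : (d ! : ℝ) * (d + p).descFactorial p = (d + p)! := by
    have hmul := Nat.factorial_mul_descFactorial hp
    rw [Nat.add_sub_cancel] at hmul
    exact_mod_cast hmul
  have hasc : (a.ascFactorial d : ℝ) * (d + p).descFactorial p ≤ a.ascFactorial (d + p) := by
    rw [← Nat.ascFactorial_mul_ascFactorial, Nat.add_descFactorial_eq_ascFactorial]
    exact_mod_cast Nat.mul_le_mul_left _ (Nat.ascFactorial_le _ (by omega))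
  rw [Nat.add_sub_cancel, theta, theta, ← hfac, Real.rpow_sub_one hdesc.ne', div_mul_div_comm,
    ← Real.mul_rpow (by positivity) (by positivity)]
  gcongr

theorem theta_mono_right (hσ : 1 ≤ σ) {a : ℕ} (ha : 1 ≤ a) {l l' : ℕ} (h : l ≤ l') :
    theta σ a l ≤ theta σ a l' := by
  have hle := theta_mul_descFactorial_le (zero_le_one.trans hσ) ha (Nat.sub_le l' l)
  rw [Nat.sub_sub_self h] at hle
  refine (le_mul_of_one_le_right (theta_nonneg _ _ _)
    (Real.one_le_rpow ?_ (by linarith))).trans hle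
  exact_mod_cast Nat.descFactorial_pos.2 (Nat.sub_le l' l)

theorem ascFactorial_succ_eq (c n : ℕ) : c.ascFactorial (n + 1) = c * (c + 1).ascFactorial n :=
  (Nat.succ_ascFactorial c n).symm

theorem sum_choose_mul_ascFactorial (a b l : ℕ) :
    ∑ p ∈ antidiagonal l, l.choose p.1 * (a.ascFactorial p.1 * b.ascFactorial p.2) =
      (a + b).ascFactorial l := by
  induction l generalizing a b with
  | zero => simp
  | succ l ih =>
    have hpascal := Finset.sum_antidiagonal_choose_succ_mul
      (fun i j => a.ascFactorial i * b.ascFactorial j) l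
    have hsnd : ∑ p ∈ antidiagonal l,
        l.choose p.1 * (a.ascFactorial p.1 * b.ascFactorial (p.2 + 1)) =
        b * (a + b + 1).ascFactorial l := by
      rw [add_assoc, ← ih a (b + 1), Finset.mul_sum]
      refine Finset.sum_congr rfl fun p _ => ?_
      rw [ascFactorial_succ_eq]; ring
    have hfst : ∑ p ∈ antidiagonal l,
        l.choose p.2 * (a.ascFactorial (p.1 + 1) * b.ascFactorial p.2) =
        a * (a + b + 1).ascFactorial l := by
      rw [add_right_comm, ← ih (a + 1) b, Finset.mul_sum]
      refine Finset.sum_congr rfl fun p hp => ?_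
      rw [ascFactorial_succ_eq, Nat.choose_symm_of_eq_add (mem_antidiagonal.1 hp).symm]; ring
    simp only [Nat.cast_id] at hpascal
    rw [hpascal, hsnd, hfst, ascFactorial_succ_eq]
    ring

theorem sum_rpow_le_rpow_sum (hσ : 1 ≤ σ) {ι : Type*} (s : Finset ι) {f : ι → ℝ}
    (hf : ∀ i ∈ s, 0 ≤ f i) : ∑ i ∈ s, f i ^ σ ≤ (∑ i ∈ s, f i) ^ σ := by
  have hsplit : ∀ x : ℝ, 0 ≤ x → x ^ σ = x * x ^ (σ - 1) := fun x hx => by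
    rw [← Real.rpow_one_add' hx (by linarith), add_sub_cancel]
  rw [hsplit _ (Finset.sum_nonneg hf), Finset.sum_mul]
  refine Finset.sum_le_sum fun i hi => ?_
  rw [hsplit _ (hf i hi)]
  exact mul_le_mul_of_nonneg_left (Real.rpow_le_rpow (hf i hi) (Finset.single_le_sum hf hi)
    (by linarith)) (hf i hi)

theorem theta_mul_theta_le (hσ : 1 ≤ σ) (a b : ℕ) {i j l : ℕ} (h : i + j = l) :
    theta σ a i * theta σ b j ≤
      ((l.choose i * (a.ascFactorial i * b.ascFactorial j) : ℕ) : ℝ) ^ σ / (l ! : ℝ) := by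
  have hchoose : (1 : ℝ) ≤ l.choose i := by exact_mod_cast Nat.choose_pos (by omega)
  have hfac : (l.choose i : ℝ) * (i ! * j !) = l ! := by
    have hmul := Nat.choose_mul_factorial_mul_factorial (show i ≤ l by omega)
    rw [show l - i = j by omega, mul_assoc] at hmul
    exact_mod_cast hmul
  rw [theta, theta, ← hfac]
  push_cast
  rw [Real.mul_rpow (by positivity) (by positivity), Real.mul_rpow (by positivity)
    (by positivity), div_mul_div_comm]
  calc _ = (l.choose i : ℝ) * ((a.ascFactorial i : ℝ) ^ σ * (b.ascFactorial j : ℝ) ^ σ) /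
        ((l.choose i : ℝ) * (i ! * j !)) := by
        rw [mul_div_mul_left _ _ (zero_lt_one.trans_le hchoose).ne']
    _ ≤ _ := by
        gcongr
        exact Real.self_le_rpow_of_one_le hchoose hσ

theorem sum_theta_mul_theta_le (hσ : 1 ≤ σ) (a b l : ℕ) :
    ∑ p ∈ antidiagonal l, theta σ a p.1 * theta σ b p.2 ≤ theta σ (a + b) l := by
  refine (Finset.sum_le_sum fun p hp =>
    theta_mul_theta_le hσ a b (mem_antidiagonal.1 hp)).trans ?_
  rw [← Finset.sum_div, theta, ← sum_choose_mul_ascFactorial, Nat.cast_sum]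
  gcongr
  exact sum_rpow_le_rpow_sum hσ _ fun _ _ => by positivity

theorem theta_le (hσ : 0 ≤ σ) (a l : ℕ) :
    theta σ a l ≤ (2 ^ (a + l)) ^ σ * (l ! : ℝ) ^ (σ - 1) := by
  have hasc : a.ascFactorial l ≤ 2 ^ (a + l) * l ! := by
    refine (Nat.ascFactorial_le l (Nat.le_succ a)).trans ?_
    rw [Nat.ascFactorial_eq_factorial_mul_choose, mul_comm]
    exact Nat.mul_le_mul_right _ (Nat.choose_le_two_pow _ _)
  rw [theta, Real.rpow_sub_one (by positivity), ← mul_div_assoc,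
    ← Real.mul_rpow (by positivity) (by positivity)]
  gcongr
  exact_mod_cast hasc

/-- The exponent `e` such that the operator `x^q ∂_x^α` turns the majorant `theta σ a` into a
multiple of size `a^e` of a majorant of the same family. -/
def lossExponent (σ : ℝ) (q α : ℕ) : ℝ :=
  if q < α then σ * ((α : ℝ) - q) + q else α

theorem ascFactorial_le_pow (a n : ℕ) : a.ascFactorial n ≤ (a + n) ^ n :=
  (Nat.ascFactorial_le n (Nat.le_succ a)).trans (Nat.ascFactorial_le_pow_add a n)

theorem descFactorial_mul_theta_add (σ : ℝ) (a l α : ℕ) :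
    ((l + α).descFactorial α : ℝ) * theta σ a (l + α) =
      (a.ascFactorial α : ℝ) ^ σ * theta σ (a + α) l := by
  have hfac : (l ! : ℝ) * (l + α).descFactorial α = (l + α)! := by
    have hmul := Nat.factorial_mul_descFactorial (Nat.le_add_left α l)
    rw [Nat.add_sub_cancel] at hmul
    exact_mod_cast hmul
  have hdesc : ((l + α).descFactorial α : ℝ) ≠ 0 := by
    exact_mod_cast (Nat.descFactorial_pos.2 (Nat.le_add_left α l)).ne'
  rw [theta, theta, ← hfac, add_comm l α, ← Nat.ascFactorial_mul_ascFactorial, Nat.cast_mul,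
    Real.mul_rpow (by positivity) (by positivity)]
  rw [add_comm l α] at hdesc
  field_simp

theorem descFactorial_mul_ascFactorial_le {b : ℕ} (hb : 1 ≤ b) (l q : ℕ) :
    l.descFactorial q * b.ascFactorial l ≤ b.ascFactorial q * (b + q).ascFactorial l := by
  have hdesc : l.descFactorial q ≤ (b + l).ascFactorial q := by
    rcases le_or_gt q l with h | h
    · obtain ⟨d, rfl⟩ := Nat.exists_eq_add_of_le' h
      rw [Nat.add_descFactorial_eq_ascFactorial]
      exact Nat.ascFactorial_le _ (by omega)
    · rw [Nat.descFactorial_of_lt h]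
      exact Nat.zero_le _
  calc l.descFactorial q * b.ascFactorial l
      ≤ (b + l).ascFactorial q * b.ascFactorial l := Nat.mul_le_mul_right _ hdesc
    _ = b.ascFactorial q * (b + q).ascFactorial l := by
      rw [mul_comm, Nat.ascFactorial_mul_ascFactorial, Nat.ascFactorial_mul_ascFactorial,
        add_comm]

theorem descFactorial_mul_theta_le (hσ : 1 ≤ σ) {b : ℕ} (hb : 1 ≤ b) (l q : ℕ) :
    (l.descFactorial q : ℝ) * theta σ b l ≤ (b.ascFactorial q : ℝ) * theta σ (b + q) l := by
  have hbl : (0 : ℝ) < b.ascFactorial l := by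
    exact_mod_cast (Nat.factorial_pos l).trans_le (factorial_le_ascFactorial hb l)
  set r : ℝ := ((b + q).ascFactorial l : ℝ) / b.ascFactorial l with hr
  have hr1 : 1 ≤ r := by
    rw [hr, one_le_div hbl]
    exact_mod_cast Nat.ascFactorial_le l (Nat.le_add_right b q)
  have hdesc : (l.descFactorial q : ℝ) ≤ b.ascFactorial q * r := by
    rw [hr, ← mul_div_assoc, le_div_iff₀ hbl]
    exact_mod_cast descFactorial_mul_ascFactorial_le hb l q
  have htheta : theta σ (b + q) l = r ^ σ * theta σ b l := by
    rw [theta, theta, hr, Real.div_rpow (by positivity) (by positivity)]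
    field_simp
  rw [htheta, ← mul_assoc]
  refine mul_le_mul_of_nonneg_right (hdesc.trans ?_) (theta_nonneg _ _ _)
  gcongr
  exact Real.self_le_rpow_of_one_le hr1 hσ

theorem descFactorial_mul_theta_add_le (hσ : 1 ≤ σ) {a : ℕ} (ha : 1 ≤ a) (q l d : ℕ) :
    ((l + d).descFactorial (q + d) : ℝ) * theta σ a (l + d) ≤
      ((a : ℝ) + (q + d : ℕ)) ^ (σ * d + q) * theta σ (a + (q + d)) l := by
  have hbase : (0 : ℝ) < (a : ℝ) + (q + d : ℕ) := by positivity
  have hsplit : ((l + d).descFactorial (q + d) : ℝ) =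
      (l + d).descFactorial d * l.descFactorial q := by
    rw [← Nat.descFactorial_mul_descFactorial (Nat.le_add_left d q), Nat.add_sub_cancel,
      Nat.add_sub_cancel, Nat.cast_mul, mul_comm]
  have hd : (a.ascFactorial d : ℝ) ≤ ((a : ℝ) + (q + d : ℕ)) ^ d := by
    exact_mod_cast (ascFactorial_le_pow a d).trans (Nat.pow_le_pow_left (by omega) d)
  have hq : ((a + d).ascFactorial q : ℝ) ≤ ((a : ℝ) + (q + d : ℕ)) ^ q := by
    exact_mod_cast (ascFactorial_le_pow (a + d) q).trans (Nat.pow_le_pow_left (by omega) q)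
  have htheta : (l.descFactorial q : ℝ) * theta σ (a + d) l ≤
      ((a : ℝ) + (q + d : ℕ)) ^ q * theta σ (a + (q + d)) l := by
    refine (descFactorial_mul_theta_le hσ (by omega) l q).trans ?_
    rw [show a + d + q = a + (q + d) by ring]
    exact mul_le_mul_of_nonneg_right hq (theta_nonneg _ _ _)
  calc _ = (a.ascFactorial d : ℝ) ^ σ * ((l.descFactorial q : ℝ) * theta σ (a + d) l) := by
        rw [hsplit, mul_right_comm, descFactorial_mul_theta_add]; ring
    _ ≤ (((a : ℝ) + (q + d : ℕ)) ^ d) ^ σ *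
        (((a : ℝ) + (q + d : ℕ)) ^ q * theta σ (a + (q + d)) l) := by
        gcongr
        exact mul_nonneg (by positivity) (theta_nonneg _ _ _)
    _ = _ := by
        rw [Real.rpow_add hbase, Real.rpow_natCast, mul_comm σ, Real.rpow_mul hbase.le,
          Real.rpow_natCast, mul_assoc]

theorem descFactorial_mul_theta_shift_le (hσ : 1 ≤ σ) {a : ℕ} (ha : 1 ≤ a) {q l : ℕ}
    (hq : q ≤ l) (α : ℕ) :
    ((l - q + α).descFactorial α : ℝ) * theta σ a (l - q + α) ≤
      ((a : ℝ) + α) ^ lossExponent σ q α * theta σ (a + α) l := by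
  unfold lossExponent
  split_ifs with hqα
  · obtain ⟨d, rfl⟩ := Nat.exists_eq_add_of_le hqα.le
    have hle := descFactorial_mul_theta_add_le hσ ha q l d
    rw [show l - q + (q + d) = l + d by omega, Nat.cast_add q d, add_sub_cancel_left]
    rwa [Nat.cast_add q d] at hle
  · rw [Real.rpow_natCast]
    refine (descFactorial_mul_theta_le hσ ha (l - q + α) α).trans ?_
    exact mul_le_mul (by exact_mod_cast ascFactorial_le_pow a α)
      (theta_mono_right hσ (by omega) (by omega)) (theta_nonneg _ _ _) (by positivity)

end Theta

/-! ### Majorants in `x` and in `t` -/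

/-- The coefficient of `t^k` of a series in `(t, x)`, as a series in `x`. -/
def row (f : MvPowerSeries (Fin 2) ℂ) (k : ℕ) : PowerSeries ℂ :=
  PowerSeries.mk fun l => coeffTX f k l

@[simp] theorem coeff_row (f : MvPowerSeries (Fin 2) ℂ) (k l : ℕ) :
    PowerSeries.coeff l (row f k) = coeffTX f k l :=
  PowerSeries.coeff_mk _ _

theorem row_mul (f g : MvPowerSeries (Fin 2) ℂ) (k : ℕ) :
    row (f * g) k = ∑ a ∈ antidiagonal k, row f a.1 * row g a.2 := by
  ext l
  simp only [coeff_row, coeffTX_mul, map_sum, PowerSeries.coeff_mul]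

/-- The series `f` in `x` is majorized by `C ∑ θ_{a,l} (x / R)^l`, where `θ_{a,l}` is
`theta σ a l`. -/
def RowBound (σ R C : ℝ) (a : ℕ) (f : PowerSeries ℂ) : Prop :=
  ∀ l, ‖PowerSeries.coeff l f‖ ≤ C * theta σ a l / R ^ l

section Majorants

variable {σ R A : ℝ}

theorem RowBound.mono {C C' : ℝ} {a : ℕ} {f : PowerSeries ℂ} (hR : 0 < R)
    (hf : RowBound σ R C a f) (h : C ≤ C') : RowBound σ R C' a f := fun l =>
  (hf l).trans (by have := theta_nonneg σ a l; gcongr)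

theorem RowBound.sum {ι : Type*} {s : Finset ι} {C : ι → ℝ} {a : ℕ} {f : ι → PowerSeries ℂ}
    (h : ∀ i ∈ s, RowBound σ R (C i) a (f i)) :
    RowBound σ R (∑ i ∈ s, C i) a (∑ i ∈ s, f i) := by
  intro l
  rw [map_sum, Finset.sum_mul, Finset.sum_div]
  exact norm_sum_le_of_le _ fun i hi => h i hi l

theorem RowBound.mul (hσ : 1 ≤ σ) (hR : 0 < R) {C C' : ℝ} {a a' : ℕ} {f g : PowerSeries ℂ}
    (hC : 0 ≤ C) (hC' : 0 ≤ C') (hf : RowBound σ R C a f) (hg : RowBound σ R C' a' g) :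
    RowBound σ R (C * C') (a + a') (f * g) := by
  intro l
  rw [PowerSeries.coeff_mul]
  have hterm : ∀ p ∈ antidiagonal l,
      ‖PowerSeries.coeff p.1 f * PowerSeries.coeff p.2 g‖ ≤
        C * C' / R ^ l * (theta σ a p.1 * theta σ a' p.2) := by
    intro p hp
    have hθ := theta_nonneg σ a p.1
    rw [norm_mul]
    refine (mul_le_mul (hf p.1) (hg p.2) (norm_nonneg _) (by positivity)).trans_eq ?_
    rw [← mem_antidiagonal.1 hp, pow_add]
    field_simp
  refine (norm_sum_le_of_le _ hterm).trans ?_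
  rw [← Finset.mul_sum, mul_div_right_comm (C * C')]
  exact mul_le_mul_of_nonneg_left (sum_theta_mul_theta_le hσ a a' l) (by positivity)

theorem sum_range_one_div_sq_le (k : ℕ) :
    ∑ i ∈ range (k + 1), 1 / ((i : ℝ) + 1) ^ 2 ≤ 2 - 1 / ((k : ℝ) + 1) := by
  induction k with
  | zero => norm_num
  | succ k ih =>
    rw [Finset.sum_range_succ]
    have htelescope : 1 / (((k + 1 : ℕ) : ℝ) + 1) ^ 2 ≤
        1 / ((k : ℝ) + 1) - 1 / (((k + 1 : ℕ) : ℝ) + 1) := by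
      push_cast
      rw [div_sub_div _ _ (by positivity) (by positivity),
        div_le_div_iff₀ (by positivity) (by positivity)]
      nlinarith [(Nat.cast_nonneg k : (0 : ℝ) ≤ k)]
    linarith

/-- The weight `(i + 1)^{-s} (j + 1)^{-2}` with the larger of the two indices carrying the
exponent `s`: in a product of two series only one factor is charged with the strong decay. -/
def splitWeight (s i j : ℕ) : ℝ :=
  if j ≤ i then 1 / (((i : ℝ) + 1) ^ s * ((j : ℝ) + 1) ^ 2)
  else 1 / (((i : ℝ) + 1) ^ 2 * ((j : ℝ) + 1) ^ s)

theorem splitWeight_le (s : ℕ) {i j k : ℕ} (h : i + j = k) :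
    splitWeight s i j ≤
      2 ^ s / ((k : ℝ) + 1) ^ s * (1 / ((i : ℝ) + 1) ^ 2 + 1 / ((j : ℝ) + 1) ^ 2) := by
  have hk : (k : ℝ) = i + j := by exact_mod_cast h.symm
  have hlarge : ∀ x : ℝ, 0 ≤ x → (k : ℝ) ≤ 2 * x →
      1 / (x + 1) ^ s ≤ 2 ^ s / ((k : ℝ) + 1) ^ s := by
    intro x hx hkx
    rw [div_le_div_iff₀ (by positivity) (by positivity), one_mul, ← mul_pow]
    gcongr
    linarith
  unfold splitWeight
  split_ifs with hji
  · have hji' : (j : ℝ) ≤ i := by exact_mod_cast hji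
    rw [← one_div_mul_one_div]
    exact mul_le_mul (hlarge _ (by positivity) (by linarith)) (le_add_of_nonneg_left
      (by positivity)) (by positivity) (by positivity)
  · have hij : (i : ℝ) ≤ j := by exact_mod_cast (not_le.1 hji).le
    rw [← one_div_mul_one_div, mul_comm]
    exact mul_le_mul (hlarge _ (by positivity) (by linarith)) (le_add_of_nonneg_right
      (by positivity)) (by positivity) (by positivity)

theorem sum_splitWeight_le (s k : ℕ) :
    ∑ a ∈ antidiagonal k, splitWeight s a.1 a.2 ≤ 2 ^ (s + 2) / ((k : ℝ) + 1) ^ s := by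
  have hfst : ∑ a ∈ antidiagonal k, 1 / ((a.1 : ℝ) + 1) ^ 2 ≤ 2 := by
    rw [Finset.Nat.sum_antidiagonal_eq_sum_range_succ_mk]
    exact (sum_range_one_div_sq_le k).trans (sub_le_self _ (by positivity))
  have hsnd : ∑ a ∈ antidiagonal k, 1 / ((a.2 : ℝ) + 1) ^ 2 ≤ 2 := by
    rw [← Finset.Nat.sum_antidiagonal_swap]
    exact hfst
  calc ∑ a ∈ antidiagonal k, splitWeight s a.1 a.2
      ≤ ∑ a ∈ antidiagonal k, 2 ^ s / ((k : ℝ) + 1) ^ s *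
          (1 / ((a.1 : ℝ) + 1) ^ 2 + 1 / ((a.2 : ℝ) + 1) ^ 2) :=
        Finset.sum_le_sum fun a ha => splitWeight_le s (mem_antidiagonal.1 ha)
    _ ≤ 2 ^ s / ((k : ℝ) + 1) ^ s * (2 + 2) := by
        rw [← Finset.mul_sum, Finset.sum_add_distrib]
        gcongr
    _ = _ := by ring

variable {M s q N b b' : ℕ} {C C' : ℝ} {f g : MvPowerSeries (Fin 2) ℂ}

/-- For `k < N` the coefficient of `t^k` in `x^q f` is majorized with a constant decaying like
`A^k (k + 1)^{-s}` and with the parameter `M k + b` in `theta`. -/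
def TBound (σ R A : ℝ) (M s q N b : ℕ) (C : ℝ) (f : MvPowerSeries (Fin 2) ℂ) : Prop :=
  ∀ k < N, RowBound σ R (C * R ^ q * A ^ k / ((k : ℝ) + 1) ^ s) (M * k + b)
    (PowerSeries.X ^ q * row f k)

theorem TBound.mono (hR : 0 < R) (hA : 0 < A) (h : TBound σ R A M s q N b C f) (hC : C ≤ C') :
    TBound σ R A M s q N b C' f := fun k hk => (h k hk).mono hR (by gcongr)

theorem TBound.mul (hσ : 1 ≤ σ) (hR : 0 < R) (hA : 0 < A) (hC : 0 ≤ C) (hC' : 0 ≤ C')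
    (hf : TBound σ R A M 2 0 N b C f) (hf' : TBound σ R A M s q N b C f)
    (hg : TBound σ R A M 2 0 N b' C' g) (hg' : TBound σ R A M s q N b' C' g) :
    TBound σ R A M s q N (b + b') (C * C' * 2 ^ (s + 2)) (f * g) := by
  intro k hk
  rw [row_mul, Finset.mul_sum]
  refine RowBound.mono hR (RowBound.sum (C := fun a => C * C' * R ^ q * A ^ k *
    splitWeight s a.1 a.2) fun a ha => ?_) ?_
  · have hsum := mem_antidiagonal.1 ha
    rw [show M * k + (b + b') = (M * a.1 + b) + (M * a.2 + b') by rw [← hsum]; ring]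
    unfold splitWeight
    split_ifs
    · have hlow := hg a.2 (by omega)
      rw [pow_zero, pow_zero, one_mul] at hlow
      have hprod := RowBound.mul hσ hR (by positivity) (by positivity) (hf' a.1 (by omega)) hlow
      rw [mul_assoc (PowerSeries.X ^ q)] at hprod
      refine hprod.mono hR (le_of_eq ?_)
      rw [← hsum, pow_add]
      field_simp
    · have hlow := hf a.1 (by omega)
      rw [pow_zero, pow_zero, one_mul] at hlow
      have hprod := RowBound.mul hσ hR (by positivity) (by positivity) hlow (hg' a.2 (by omega))
      rw [mul_left_comm] at hprod
      refine hprod.mono hR (le_of_eq ?_)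
      rw [← hsum, pow_add]
      field_simp
  · rw [← Finset.mul_sum]
    refine (mul_le_mul_of_nonneg_left (sum_splitWeight_le s k) (by positivity)).trans_eq ?_
    ring

/-- The pair of bounds, with weak decay for `f` and strong decay for `x^q f`, normalized so that
the constants of a product multiply. -/
structure ProdBound (σ R A : ℝ) (M s q N b : ℕ) (C : ℝ) (f : MvPowerSeries (Fin 2) ℂ) :
    Prop where
  low : TBound σ R A M 2 0 N b (C / 2 ^ (s + 2)) f
  high : TBound σ R A M s q N b (C / 2 ^ (s + 2)) f

theorem ProdBound.mul (hσ : 1 ≤ σ) (hR : 0 < R) (hA : 0 < A) (hs : 2 ≤ s) (hC : 0 ≤ C)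
    (hC' : 0 ≤ C') (hf : ProdBound σ R A M s q N b C f) (hg : ProdBound σ R A M s q N b' C' g) :
    ProdBound σ R A M s q N (b + b') (C * C') (f * g) := by
  constructor
  · refine (TBound.mul hσ hR hA (by positivity) (by positivity) hf.low hf.low hg.low
      hg.low).mono hR hA ?_
    calc C / 2 ^ (s + 2) * (C' / 2 ^ (s + 2)) * 2 ^ (2 + 2) ≤
        C / 2 ^ (s + 2) * (C' / 2 ^ (s + 2)) * 2 ^ (s + 2) := by gcongr; norm_num
      _ = _ := by field_simp
  · refine (TBound.mul hσ hR hA (by positivity) (by positivity) hf.low hf.high hg.low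
      hg.high).mono hR hA (le_of_eq ?_)
    field_simp

/-- The bound for a product of `d` series having the same `ProdBound`. The empty product has to
be kept apart, because `x^q` itself is not small. -/
def PowBound (σ R A : ℝ) (M s q N b : ℕ) (C : ℝ) (d : ℕ) (f : MvPowerSeries (Fin 2) ℂ) : Prop :=
  (d = 0 ∧ f = 1) ∨ ProdBound σ R A M s q N (d * b) (C ^ d) f

theorem PowBound.mul (hσ : 1 ≤ σ) (hR : 0 < R) (hA : 0 < A) (hs : 2 ≤ s) (hC : 0 ≤ C)
    {d d' : ℕ} (hf : PowBound σ R A M s q N b C d f) (hg : PowBound σ R A M s q N b C d' g) :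
    PowBound σ R A M s q N b C (d + d') (f * g) := by
  rcases hf with ⟨rfl, rfl⟩ | hf
  · simpa using hg
  rcases hg with ⟨rfl, rfl⟩ | hg
  · rw [add_zero, mul_one]
    exact Or.inr hf
  · rw [PowBound, add_mul, pow_add]
    exact Or.inr (hf.mul hσ hR hA hs (by positivity) (by positivity) hg)

theorem ProdBound.pow (hσ : 1 ≤ σ) (hR : 0 < R) (hA : 0 < A) (hs : 2 ≤ s) (hC : 0 ≤ C)
    (hf : ProdBound σ R A M s q N b C f) (d : ℕ) : PowBound σ R A M s q N b C d (f ^ d) := by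
  induction d with
  | zero => exact Or.inl ⟨rfl, pow_zero _⟩
  | succ d ih =>
    rw [pow_succ]
    exact ih.mul hσ hR hA hs hC (Or.inr (by simpa using hf))

theorem PowBound.prod (hσ : 1 ≤ σ) (hR : 0 < R) (hA : 0 < A) (hs : 2 ≤ s) (hC : 0 ≤ C)
    {ι : Type*} (t : Finset ι) {f : ι → MvPowerSeries (Fin 2) ℂ} (d : ι → ℕ)
    (hf : ∀ i ∈ t, d i ≠ 0 → ProdBound σ R A M s q N b C (f i)) :
    PowBound σ R A M s q N b C (∑ i ∈ t, d i) (∏ i ∈ t, f i ^ d i) := by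
  classical
  induction t using Finset.induction_on with
  | empty => exact Or.inl ⟨rfl, rfl⟩
  | insert a t ha ih =>
    rw [Finset.prod_insert ha, Finset.sum_insert ha]
    refine PowBound.mul hσ hR hA hs hC ?_ (ih fun i hi => hf i (Finset.mem_insert_of_mem hi))
    by_cases hda : d a = 0
    · exact Or.inl ⟨hda, by rw [hda, pow_zero]⟩
    · exact (hf a (Finset.mem_insert_self a t) hda).pow hσ hR hA hs hC (d a)

end Majorants

/-! ### The loss of derivatives in the nonlinear terms -/

section Loss

variable {m : ℕ} {F : (Var m → ℂ) → ℂ} {σ : ℝ}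

theorem coeff_nonlinearPart {n : Var m → ℕ} (hn : 2 ≤ n (varT m) + zDegree n) :
    MvPowerSeries.coeff (Finsupp.equivFunOnFinite.symm n) (nonlinearPart F) = taylorCoeff F n := by
  rw [MvPowerSeries.coeff_apply, nonlinearPart]
  exact if_pos hn

theorem mem_indexSetMu_of_taylorCoeff_ne_zero {n : Var m → ℕ} (hn : IsRest n)
    (hne : taylorCoeff F n ≠ 0) {q : {q : ℕ × ℕ // q ∈ indexSet m}} (hq : n (varZ q) ≠ 0)
    (hx : n (varX m) < q.1.2) : q ∈ indexSetMu F (n (varX m)) := by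
  refine ⟨hx, fun hzero => ?_⟩
  have hdeg : 2 ≤ n (varT m) + zDegree n := by
    have := le_zDegree n q
    rcases hn with hn | hn <;> omega
  set N : Var m →₀ ℕ := Finsupp.equivFunOnFinite.symm n with hN
  set d : Var m →₀ ℕ := N - Finsupp.single (varX m) (n (varX m)) - Finsupp.single (varZ q) 1 with hd
  have hdx : d (varX m) = 0 := by simp [hd, hN]
  have hxN : Finsupp.single (varX m) (n (varX m)) ≤ N := by simp [hN]
  have hzN : Finsupp.single (varZ q) 1 ≤ N - Finsupp.single (varX m) (n (varX m)) := by
    simp [hN, Nat.one_le_iff_ne_zero, hq]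
  have hcoeff := congrArg (MvPowerSeries.coeff d) hzero
  rw [MvPowerSeries.coeff_apply, restrictX, if_pos hdx, MvPowerSeries.coeff_pderiv,
    coeff_iterate_pderiv, hd, tsub_add_cancel_of_le hzN, tsub_add_cancel_of_le hxN,
    coeff_nonlinearPart hdeg, map_zero] at hcoeff
  refine mul_ne_zero (mul_ne_zero ?_ hne) (Nat.cast_add_one_ne_zero _) hcoeff
  exact_mod_cast (Nat.descFactorial_pos.2 (Nat.le_add_left _ _)).ne'

theorem lossExponent_nonneg (hσ : 0 ≤ σ) (q α : ℕ) : 0 ≤ lossExponent σ q α := by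
  unfold lossExponent
  split_ifs with h
  · have hle : (0 : ℝ) ≤ (α : ℝ) - q := sub_nonneg.2 (by exact_mod_cast h.le)
    positivity
  · positivity

theorem lossExponent_le (hσ : 1 ≤ σ) (q α : ℕ) : lossExponent σ q α ≤ σ * α := by
  unfold lossExponent
  split_ifs <;> nlinarith [(Nat.cast_nonneg q : (0 : ℝ) ≤ q), (Nat.cast_nonneg α : (0 : ℝ) ≤ α)]

/-- The upper bound for `σ₀` by the slopes `(m - j - μ) / (α - μ)` with `(j, α) ∈ I_{m,μ}`. -/
def IrregularityBound (F : (Var m → ℂ) → ℂ) : Prop :=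
  ∀ mu : ℕ, mu < m → ∀ q ∈ indexSetMu F mu,
    irregularity F ≤ ((m : ℝ) - q.1.1 - mu) / ((q.1.2 : ℝ) - mu)

theorem IrregularityBound.add_lossExponent_le (hσ : IrregularityBound F)
    {n : Var m → ℕ} (hn : IsRest n) (hne : taylorCoeff F n ≠ 0)
    {q : {q : ℕ × ℕ // q ∈ indexSet m}} (hq : n (varZ q) ≠ 0) :
    (q.1.1 : ℝ) + lossExponent (irregularity F) (n (varX m)) q.1.2 ≤ m := by
  have hI := (mem_indexSet.1 q.2).1
  unfold lossExponent
  split_ifs with hx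
  · have hle := hσ (n (varX m)) (by omega) q
      (mem_indexSetMu_of_taylorCoeff_ne_zero hn hne hq hx)
    rw [le_div_iff₀ (sub_pos.2 (by exact_mod_cast hx))] at hle
    linarith
  · exact_mod_cast hI

/-- The bound for the coefficients of `t, …, t^N` of the solution `u` in the induction. -/
def SolutionBound (σ R A ε : ℝ) (m S N : ℕ) (u : MvPowerSeries (Fin 2) ℂ) : Prop :=
  ∀ k < N, RowBound σ R (ε * A ^ k / ((k : ℝ) + 1) ^ S) (3 * m * k + m) (row u (k + 1))

variable {R A ε : ℝ} {u : MvPowerSeries (Fin 2) ℂ} {T : ℕ}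

theorem pow_mul_rpow_lossExponent_le (hm : 1 ≤ m) {j α J k : ℕ} (hα : α ≤ m) {e : ℝ}
    (he : 0 ≤ e) (hT : e ≤ T) (hJ : j + e ≤ J) :
    ((k : ℝ) + 1) ^ j * (((3 * m * k + m : ℕ) : ℝ) + α) ^ e ≤
      (3 * m : ℝ) ^ T * ((k : ℝ) + 1) ^ J := by
  have hm' : (1 : ℝ) ≤ m := by exact_mod_cast hm
  have hα' : (α : ℝ) ≤ m := by exact_mod_cast hα
  have hk : (1 : ℝ) ≤ (k : ℝ) + 1 := le_add_of_nonneg_left (Nat.cast_nonneg k)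
  have hbase : ((3 * m * k + m : ℕ) : ℝ) + α ≤ 3 * m * ((k : ℝ) + 1) := by
    push_cast
    linarith
  calc _ ≤ ((k : ℝ) + 1) ^ j * (3 * m * ((k : ℝ) + 1)) ^ e := by gcongr
    _ = (3 * m : ℝ) ^ e * ((k : ℝ) + 1) ^ (j + e) := by
        rw [Real.mul_rpow (by positivity) (by positivity), Real.rpow_add (by positivity),
          Real.rpow_natCast]
        ring
    _ ≤ (3 * m : ℝ) ^ (T : ℝ) * ((k : ℝ) + 1) ^ (J : ℝ) := by
        gcongr
        linarith
    _ = _ := by rw [Real.rpow_natCast, Real.rpow_natCast]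

theorem inv_pow_sub_add_le (hR : 0 < R) (hR1 : R ≤ 1) {x l α : ℕ} (hx : x ≤ l) (hα : α ≤ m) :
    1 / R ^ (l - x + α) ≤ R ^ x / (R ^ l * R ^ m) := by
  rw [div_le_div_iff₀ (by positivity) (by positivity), one_mul, ← pow_add, ← pow_add]
  exact pow_le_pow_of_le_one hR.le hR1 (by omega)

theorem SolutionBound.tBound_jet (hσ : 1 ≤ σ) (hm : 1 ≤ m) (hR : 0 < R) (hR1 : R ≤ 1)
    (hA : 0 < A) (hε : 0 ≤ ε) {J s N : ℕ} (hu : SolutionBound σ R A ε m (J + s) N u)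
    (q : {q : ℕ × ℕ // q ∈ indexSet m}) {x : ℕ}
    (hT : lossExponent σ x q.1.2 ≤ T) (hJ : (q.1.1 : ℝ) + lossExponent σ x q.1.2 ≤ J) :
    TBound σ R A (3 * m) s x N (2 * m) (ε * (3 * m) ^ T / R ^ m)
      (shiftT (jet m u (varZ q))) := by
  intro k hk l
  obtain ⟨⟨j, α⟩, hI⟩ := q
  have hα : α ≤ m := (Nat.le_add_left α j).trans (mem_indexSet.1 hI).1
  simp only at hT hJ
  have hθ := theta_nonneg σ (3 * m * k + 2 * m) l
  rw [PowerSeries.coeff_X_pow_mul']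
  split_ifs with hx
  swap
  · rw [norm_zero]; positivity
  have hcoeff := hu k hk (l - x + α)
  have hshift := descFactorial_mul_theta_shift_le hσ (a := 3 * m * k + m) (by omega) hx α
  have htheta : theta σ (3 * m * k + m + α) l ≤ theta σ (3 * m * k + 2 * m) l :=
    theta_mono_left (zero_le_one.trans hσ) (by omega) l
  have hloss := pow_mul_rpow_lossExponent_le (k := k) hm hα
    (lossExponent_nonneg (zero_le_one.trans hσ) x α) hT hJ
  have hradius := inv_pow_sub_add_le hR hR1 hx hα
  have hk1 : ‖((k + 1 : ℕ) : ℂ)‖ = (k : ℝ) + 1 := by rw [Complex.norm_natCast]; push_cast; ring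
  rw [coeff_row] at hcoeff
  rw [coeff_row, shiftT, coeffTX_ofCoeff, coeffTX_jet_varZ, norm_mul, norm_mul, norm_pow, hk1,
    Complex.norm_natCast]
  set D : ℝ := ((l - x + α).descFactorial α : ℝ)
  calc ((k : ℝ) + 1) ^ j * (D * ‖coeffTX u (k + 1) (l - x + α)‖)
      ≤ ((k : ℝ) + 1) ^ j * (D * (ε * A ^ k / ((k : ℝ) + 1) ^ (J + s) *
          theta σ (3 * m * k + m) (l - x + α) / R ^ (l - x + α))) := by gcongr
    _ = ε * A ^ k / ((k : ℝ) + 1) ^ (J + s) * (1 / R ^ (l - x + α)) * (((k : ℝ) + 1) ^ j *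
          (D * theta σ (3 * m * k + m) (l - x + α))) := by ring
    _ ≤ ε * A ^ k / ((k : ℝ) + 1) ^ (J + s) * (R ^ x / (R ^ l * R ^ m)) * (((k : ℝ) + 1) ^ j *
          ((((3 * m * k + m : ℕ) : ℝ) + α) ^ lossExponent σ x α *
            theta σ (3 * m * k + 2 * m) l)) := by
        have hθ' := theta_nonneg σ (3 * m * k + m) (l - x + α)
        exact mul_le_mul (by gcongr) (mul_le_mul_of_nonneg_left (hshift.trans (by gcongr))
          (by positivity)) (by positivity) (by positivity)
    _ ≤ ε * A ^ k / ((k : ℝ) + 1) ^ (J + s) * (R ^ x / (R ^ l * R ^ m)) *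
          ((3 * m : ℝ) ^ T * ((k : ℝ) + 1) ^ J * theta σ (3 * m * k + 2 * m) l) := by
        rw [← mul_assoc (((k : ℝ) + 1) ^ j)]
        gcongr
    _ = _ := by rw [pow_add]; field_simp

theorem SolutionBound.powBound_zMonomial (hσ : 1 ≤ σ) (hm : 1 ≤ m) (hR : 0 < R) (hR1 : R ≤ 1)
    (hA : 0 < A) (hε : 0 ≤ ε) (hT : σ * m ≤ T) {N : ℕ}
    (hu : SolutionBound σ R A ε m (m + (T + 2)) N u) {n : Var m → ℕ}
    (hloss : ∀ q, n (varZ q) ≠ 0 → (q.1.1 : ℝ) + lossExponent σ (n (varX m)) q.1.2 ≤ m) :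
    PowBound σ R A (3 * m) (T + 2) (n (varX m)) N (2 * m)
      (ε * (3 * m) ^ T / R ^ m * 2 ^ (T + 4)) (zDegree n) (zMonomial u n) := by
  have hle_m (q : {q : ℕ × ℕ // q ∈ indexSet m}) : (q.1.1 : ℝ) ≤ m ∧ (q.1.2 : ℝ) ≤ m := by
    have := (mem_indexSet.1 q.2).1
    exact ⟨by exact_mod_cast (by omega : q.1.1 ≤ m), by exact_mod_cast (by omega : q.1.2 ≤ m)⟩
  have hle_T (q : {q : ℕ × ℕ // q ∈ indexSet m}) (x : ℕ) : lossExponent σ x q.1.2 ≤ T :=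
    (lossExponent_le hσ x q.1.2).trans
      ((mul_le_mul_of_nonneg_left (hle_m q).2 (zero_le_one.trans hσ)).trans hT)
  refine PowBound.prod hσ hR hA (by omega) (by positivity) _ _ fun q _ hq => ⟨?_, ?_⟩ <;>
    rw [mul_div_cancel_right₀ _ (by positivity)]
  · refine SolutionBound.tBound_jet (J := T + m) hσ hm hR hR1 hA hε ?_ q (hle_T q 0) ?_
    · rwa [show T + m + 2 = m + (T + 2) by ring]
    · push_cast
      linarith [hle_T q 0, (hle_m q).1]
  · exact hu.tBound_jet hσ hm hR hR1 hA hε q (hle_T q _) (hloss q hq)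

theorem row_jetMonomial (u : MvPowerSeries (Fin 2) ℂ) (n : Var m → ℕ) (k : ℕ) :
    row (jetMonomial u n) k = if n (varT m) + zDegree n ≤ k then
      PowerSeries.X ^ n (varX m) * row (zMonomial u n) (k - (n (varT m) + zDegree n)) else 0 := by
  ext l
  rw [coeff_row, coeffTX_jetMonomial]
  split_ifs <;> simp_all [PowerSeries.coeff_X_pow_mul']

theorem RowBound.zero (hR : 0 ≤ R) {C : ℝ} (hC : 0 ≤ C) (a : ℕ) : RowBound σ R C a 0 := fun l => by
  have := theta_nonneg σ a l
  rw [map_zero, norm_zero]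
  positivity

theorem RowBound.mono_left (hσ : 0 ≤ σ) (hR : 0 ≤ R) {C : ℝ} (hC : 0 ≤ C) {a b : ℕ} (h : a ≤ b)
    {f : PowerSeries ℂ} (hf : RowBound σ R C a f) : RowBound σ R C b f := fun l =>
  (hf l).trans (by have := theta_mono_left hσ h l; gcongr)

theorem rowBound_X_pow (hσ : 1 ≤ σ) (hR : 0 < R) {a : ℕ} (ha : 1 ≤ a) (x : ℕ) :
    RowBound σ R (R ^ x) a (PowerSeries.X ^ x) := fun l => by
  have hθ := theta_nonneg σ a l
  rw [PowerSeries.coeff_X_pow]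
  split_ifs with h
  · rw [norm_one, h, mul_div_right_comm, div_self (by positivity), one_mul]
    exact one_le_theta hσ ha x
  · rw [norm_zero]
    positivity

theorem row_one (k : ℕ) : row 1 k = if k = 0 then 1 else 0 := by
  ext l
  rw [coeff_row, coeffTX_one]
  split_ifs <;> simp_all [PowerSeries.coeff_one]

theorem rowBound_jetMonomial_of_zDegree_eq_zero (hσ : 1 ≤ σ) (hR : 0 < R) (hA : 0 < A)
    {n : Var m → ℕ} (hz : zDegree n = 0) {a k : ℕ} (ha : 1 ≤ a) (hk : 1 ≤ k) (s : ℕ) :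
    RowBound σ R (R ^ n (varX m) * (A ^ k / A ^ n (varT m)) * ((n (varT m) : ℝ) ^ s / (k : ℝ) ^ s))
      a (row (jetMonomial u n) k) := by
  rw [row_jetMonomial, hz, add_zero, zMonomial_of_zDegree_eq_zero u hz, row_one]
  split_ifs with hle hzero
  · have heq : n (varT m) = k := by omega
    rw [heq, div_self (by positivity), div_self (by positivity), mul_one, mul_one, mul_one]
    exact rowBound_X_pow hσ hR ha _
  · rw [mul_zero]
    exact RowBound.zero hR.le (by positivity) a
  · exact RowBound.zero hR.le (by positivity) a

theorem one_div_pow_sub_le {d k : ℕ} (hd : 1 ≤ d) (hdk : d ≤ k) (s : ℕ) :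
    1 / (((k - d : ℕ) : ℝ) + 1) ^ s ≤ (d : ℝ) ^ s / (k : ℝ) ^ s := by
  have hk : (0 : ℝ) < k := by exact_mod_cast hd.trans hdk
  rw [div_le_div_iff₀ (by positivity) (by positivity), one_mul, ← mul_pow]
  refine pow_le_pow_left₀ hk.le ?_ s
  obtain ⟨c, rfl⟩ := Nat.exists_eq_add_of_le hdk
  have hle : d + c ≤ d * (c + 1) := by nlinarith
  rw [Nat.add_sub_cancel_left]
  exact_mod_cast hle

theorem PowBound.rowBound_jetMonomial (hσ : 0 ≤ σ) (hR : 0 < R) (hA : 0 < A) {s : ℕ} {C : ℝ}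
    (hC : 0 ≤ C) {n : Var m → ℕ} {k : ℕ}
    (hpow : PowBound σ R A (3 * m) s (n (varX m)) k (2 * m) C (zDegree n) (zMonomial u n))
    (hz : zDegree n ≠ 0) (hd : 2 ≤ n (varT m) + zDegree n) :
    RowBound σ R (C ^ zDegree n * R ^ n (varX m) * (A ^ (k + 1) / A ^ (n (varT m) + zDegree n)) *
      (((n (varT m) + zDegree n : ℕ) : ℝ) ^ s / ((k + 1 : ℕ) : ℝ) ^ s)) (3 * m * k + m)
      (row (jetMonomial u n) (k + 1)) := by
  set d := n (varT m) + zDegree n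
  rw [row_jetMonomial]
  split_ifs with hdk
  swap
  · exact RowBound.zero hR.le (by positivity) _
  have hrow := (hpow.resolve_left fun h => hz h.1).high (k + 1 - d) (by omega)
  -- Three units of the parameter are gained for each power of `t`, against two spent on each
  -- factor of the monomial and one on the result.
  have hparam : 3 * m * (k + 1 - d) + zDegree n * (2 * m) ≤ 3 * m * k + m := by
    have hle : 3 * (k + 1 - d) + 2 * zDegree n ≤ 3 * k + 1 := by omega
    nlinarith [Nat.mul_le_mul_left m hle]
  refine (hrow.mono_left hσ hR.le (by positivity) hparam).mono hR ?_
  have hsplit : A ^ (k + 1) / A ^ d = A ^ (k + 1 - d) := by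
    rw [div_eq_iff (by positivity), ← pow_add, Nat.sub_add_cancel hdk]
  have hscale : C ^ zDegree n / 2 ^ (s + 2) ≤ C ^ zDegree n :=
    div_le_self (by positivity) (one_le_pow₀ (by norm_num))
  have hdecay := one_div_pow_sub_le (one_le_two.trans hd) hdk s
  rw [hsplit, mul_div_assoc _ (A ^ _), div_eq_mul_one_div (A ^ _), ← mul_assoc]
  gcongr

theorem SolutionBound.rowBound_jetMonomial (hσ : 1 ≤ σ) (hm : 1 ≤ m) (hR : 0 < R) (hR1 : R ≤ 1)
    (hA : 0 < A) (hε : 0 ≤ ε) (hT : σ * m ≤ T) {k : ℕ}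
    (hu : SolutionBound σ R A ε m (m + (T + 2)) k u) {n : Var m → ℕ} (hn : IsRest n)
    (hloss : ∀ q, n (varZ q) ≠ 0 → (q.1.1 : ℝ) + lossExponent σ (n (varX m)) q.1.2 ≤ m) :
    RowBound σ R ((ε * (3 * m) ^ T / R ^ m * 2 ^ (T + 4)) ^ zDegree n * R ^ n (varX m) *
      (A ^ (k + 1) / A ^ (n (varT m) + zDegree n)) *
      (((n (varT m) + zDegree n : ℕ) : ℝ) ^ (T + 2) / ((k + 1 : ℕ) : ℝ) ^ (T + 2)))
      (3 * m * k + m) (row (jetMonomial u n) (k + 1)) := by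
  by_cases hz : zDegree n = 0
  · simpa only [hz, pow_zero, one_mul, add_zero] using
      rowBound_jetMonomial_of_zDegree_eq_zero hσ hR hA hz (by omega) (Nat.le_add_left 1 k) (T + 2)
  · exact (hu.powBound_zMonomial hσ hm hR hR1 hA hε hT hloss).rowBound_jetMonomial
      (zero_le_one.trans hσ) hR hA (by positivity) hz (by rcases hn with hn | hn <;> omega)

end Loss

/-! ### The estimate of the formal solution -/

theorem sum_box_half_pow_le (m N : ℕ) :
    ∑ n ∈ box m N, (1 / 2 : ℝ) ^ (∑ v, n v) ≤ 2 ^ Fintype.card (Var m) :=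
  calc ∑ n ∈ box m N, (1 / 2 : ℝ) ^ (∑ v, n v)
      = ∏ _v : Var m, ∑ j ∈ range (N + 1), (1 / 2 : ℝ) ^ j := by
        rw [Finset.prod_univ_sum, box]
        exact Finset.sum_congr rfl fun n _ => (Finset.prod_pow_eq_pow_sum _ _ _).symm
    _ ≤ ∏ _v : Var m, (2 : ℝ) :=
        Finset.prod_le_prod (fun _ _ => Finset.sum_nonneg fun _ _ => by positivity)
          fun _ _ => sum_geometric_two_le _
    _ = 2 ^ Fintype.card (Var m) := by rw [Finset.prod_const, Finset.card_univ]

theorem sum_eq_add_zDegree {m : ℕ} (n : Var m → ℕ) :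
    ∑ v, n v = n (varT m) + n (varX m) + zDegree n := by
  rw [Fintype.sum_sum_type, Fin.sum_univ_two]; rfl

theorem exists_pow_le_mul_two_pow (p : ℕ) : ∃ P : ℝ, 0 < P ∧ ∀ d : ℕ, (d : ℝ) ^ p ≤ P * 2 ^ d := by
  obtain ⟨P, hP⟩ := (tendsto_pow_const_div_const_pow_of_one_lt p
    (one_lt_two : (1 : ℝ) < 2)).bddAbove_range
  refine ⟨max P 1, by positivity, fun d => ?_⟩
  rw [← div_le_iff₀ (by positivity)]
  exact (hP ⟨d, rfl⟩).trans (le_max_left P 1)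

theorem sum_Ico_one_pow_le {x : ℝ} (hx : 0 ≤ x) (hx2 : x ≤ 1 / 2) (l : ℕ) :
    ∑ p ∈ Ico 1 (l + 1), x ^ p ≤ 2 * x := by
  refine (geom_sum_Ico_le_of_lt_one hx (by linarith)).trans ?_
  rw [pow_one, div_le_iff₀ (by linarith)]
  nlinarith

/-- Constants that control the equation: the Taylor coefficients of `F` are bounded by
`K ρ^{|n|}`, the inverse of the indicial polynomial by means of `C`, and `P` and `T` absorb the
polynomial factors. -/
structure GrowthConstants {m : ℕ} (F : (Var m → ℂ) → ℂ) where
  (K ρ C P : ℝ)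
  T : ℕ
  K_pos : 0 < K
  one_le_ρ : 1 ≤ ρ
  C_pos : 0 < C
  P_pos : 0 < P
  norm_taylorCoeff_le : ∀ n, ‖taylorCoeff F n‖ ≤ K * ρ ^ (∑ v, n v)
  pow_le_indicial : ∀ k l : ℕ, 1 ≤ k → (k : ℝ) ^ m ≤ C * ‖indicial F k l‖
  mono_le_indicial : ∀ q ∈ indexSet m, ∀ k l p : ℕ, 1 ≤ k → 1 ≤ l → p ≤ l →
    PowerSeries.coeff p (coeffC F q) ≠ 0 →
    mono k l q ≤ C * ‖indicial F k l‖ * (l.descFactorial p : ℝ) ^ (irregularity F - 1)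
  irregularity_mul_le : irregularity F * m ≤ T
  pow_le_two_pow : ∀ d : ℕ, (d : ℝ) ^ (T + 2) ≤ P * 2 ^ d

theorem nonempty_growthConstants {m : ℕ} {F : (Var m → ℂ) → ℂ} (hF : AnalyticAt ℂ F 0)
    (hN : NonResonance F) (hGP : GeneralizedPoincare F) : Nonempty (GrowthConstants F) := by
  obtain ⟨K, ρ, hK, hρ, hcoeff⟩ := exists_norm_coeff_taylorSeries_le hF
  obtain ⟨C, hC, hpow, hmono⟩ := exists_mono_le_indicial_mul hN hGP
  obtain ⟨T, hT⟩ := exists_nat_ge (irregularity F * m)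
  obtain ⟨P, hP, hpoly⟩ := exists_pow_le_mul_two_pow (T + 2)
  refine ⟨⟨K, max ρ 1, C, P, T, hK, le_max_right _ _, hC, hP, fun n => ?_, hpow, hmono, hT, hpoly⟩⟩
  refine (hcoeff (Finsupp.equivFunOnFinite.symm n)).trans ?_
  simp only [Finsupp.equivFunOnFinite_symm_apply_apply]
  gcongr
  exact le_max_left _ _

namespace GrowthConstants

variable {m : ℕ} {F : (Var m → ℂ) → ℂ} (c : GrowthConstants F)

/-- A bound, relative to `R` and to the majorant of the solution, for the linear part of the
recursion; `R` is the scale in `x` of the majorant. -/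
def linearFactor : ℝ := (indexSet m).card * (c.K * c.ρ ^ (m + 1) * c.C * (4 * c.ρ)) + 2 * c.ρ

/-- The scale `R` in `x` of the majorant of the solution, for which the linear part of the
recursion takes up at most half of the majorant. -/
def radius : ℝ := 1 / c.linearFactor

/-- The factor by which `rest` exceeds the scale of its majorant. -/
def restFactor : ℝ := c.K * c.P * (4 * c.ρ) * 2 ^ Fintype.card (Var m)

/-- The constant factor `ε` of the majorant of the solution, for which `rest` takes up at most half
of the majorant. -/
def amplitude : ℝ := 2 * c.C * c.restFactor

/-- The constant contributed by each factor `(t ∂_t)^j ∂_x^α u` of a monomial. -/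
def jetFactor : ℝ := c.amplitude * (3 * m) ^ c.T / c.radius ^ m * 2 ^ (c.T + 4)

/-- The ratio `A` of the geometric growth in `k` of the majorant of the solution, for which a
nonlinear monomial of degree `d` is smaller by a factor `2^{-d}` than its majorant. -/
def ratio : ℝ := (4 * c.ρ * max 1 c.jetFactor) ^ 2

theorem ρ_pos : 0 < c.ρ := zero_lt_one.trans_le c.one_le_ρ

theorem two_mul_ρ_le_linearFactor : 2 * c.ρ ≤ c.linearFactor := by
  have := c.K_pos
  have := c.C_pos
  have := c.ρ_pos
  exact le_add_of_nonneg_left (by positivity)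

theorem linearFactor_pos : 0 < c.linearFactor := by
  linarith [c.ρ_pos, c.two_mul_ρ_le_linearFactor]

theorem radius_pos : 0 < c.radius := one_div_pos.2 c.linearFactor_pos

theorem radius_le_one : c.radius ≤ 1 := by
  rw [radius, div_le_one c.linearFactor_pos]
  linarith [c.one_le_ρ, c.two_mul_ρ_le_linearFactor]

theorem ρ_mul_radius_le : c.ρ * c.radius ≤ 1 / 2 := by
  rw [radius, mul_one_div, div_le_iff₀ c.linearFactor_pos]
  linarith [c.two_mul_ρ_le_linearFactor]

theorem card_mul_radius_le :
    (indexSet m).card * (c.K * c.ρ ^ (m + 1) * c.C * (2 * (c.ρ * c.radius))) ≤ 1 / 2 := by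
  have hone : c.linearFactor * c.radius = 1 := mul_one_div_cancel c.linearFactor_pos.ne'
  rw [linearFactor] at hone
  linarith [mul_pos c.ρ_pos c.radius_pos]

theorem restFactor_nonneg : 0 ≤ c.restFactor := by
  have := c.K_pos
  have := c.P_pos
  have := c.ρ_pos
  unfold restFactor
  positivity

theorem amplitude_nonneg : 0 ≤ c.amplitude :=
  mul_nonneg (mul_nonneg zero_le_two c.C_pos.le) c.restFactor_nonneg

theorem jetFactor_nonneg : 0 ≤ c.jetFactor := by
  have := c.amplitude_nonneg
  have := c.radius_pos
  unfold jetFactor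
  positivity

theorem ratio_pos : 0 < c.ratio := by
  have := c.ρ_pos
  unfold ratio
  positivity

theorem monomial_weight_le {i z : ℕ} (h : 1 ≤ i ∨ 2 ≤ z) :
    c.jetFactor ^ z * (2 * c.ρ) ^ (i + z) * (c.ratio / c.ratio ^ (i + z)) ≤
      4 * c.ρ * (1 / 2) ^ (i + z) := by
  have hρ := c.one_le_ρ
  have hJ := c.jetFactor_nonneg
  have hA := c.ratio_pos
  by_cases hlin : i = 1 ∧ z = 0
  · obtain ⟨rfl, rfl⟩ := hlin
    simp only [pow_zero, one_mul, add_zero, pow_one, div_self hA.ne', mul_one]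
    linarith
  have hd : 2 ≤ i + z := by omega
  set y := 4 * c.ρ * max 1 c.jetFactor with hy
  have hy1 : 1 ≤ y := one_le_mul_of_one_le_of_one_le (by linarith) (le_max_left _ _)
  have hbase : c.jetFactor ^ z * (2 * c.ρ) ^ (i + z) ≤ (y / 2) ^ (i + z) :=
    calc c.jetFactor ^ z * (2 * c.ρ) ^ (i + z)
        ≤ max 1 c.jetFactor ^ (i + z) * (2 * c.ρ) ^ (i + z) := by
          gcongr
          exact (pow_le_pow_left₀ hJ (le_max_right 1 _) z).trans
            (pow_le_pow_right₀ (le_max_left _ _) (Nat.le_add_left z i))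
      _ = (y / 2) ^ (i + z) := by rw [← mul_pow, hy]; congr 1; ring
  calc c.jetFactor ^ z * (2 * c.ρ) ^ (i + z) * (c.ratio / c.ratio ^ (i + z))
      ≤ (y / 2) ^ (i + z) * (c.ratio / c.ratio ^ (i + z)) := by gcongr
    _ = y ^ 2 / y ^ (i + z) * (1 / 2) ^ (i + z) := by
        rw [ratio, ← hy, ← pow_mul, mul_comm 2, pow_mul, sq (y ^ (i + z)), div_pow, one_div_pow]
        field_simp
    _ ≤ 4 * c.ρ * (1 / 2) ^ (i + z) := by
        gcongr
        rw [div_le_iff₀ (by positivity)]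
        exact (pow_le_pow_right₀ hy1 hd).trans (le_mul_of_one_le_left (by positivity) (by linarith))

/-- The majorant of the coefficient of `t^(k+1) x^l` of `rest`, up to the factor `restFactor`. -/
def scale (k l : ℕ) : ℝ :=
  c.ratio ^ k / ((k : ℝ) + 1) ^ (c.T + 2) * theta (irregularity F) (3 * m * k + m) l / c.radius ^ l

theorem scale_nonneg (k l : ℕ) : 0 ≤ c.scale k l := by
  have := c.ratio_pos
  have := c.radius_pos
  have := theta_nonneg (irregularity F) (3 * m * k + m) l
  unfold scale
  positivity

/-- The bound satisfied by the coefficients of `t, …, t^N` of the solution. -/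
abbrev Bounds (N : ℕ) (u : MvPowerSeries (Fin 2) ℂ) : Prop :=
  SolutionBound (irregularity F) c.radius c.ratio c.amplitude m (m + (c.T + 2)) N u

variable {u : MvPowerSeries (Fin 2) ℂ}

theorem norm_rest_term_le (hm : 1 ≤ m) (hσ : IrregularityBound F) {k : ℕ} (hu : c.Bounds k u)
    {n : Var m → ℕ} (hn : IsRest n) (l : ℕ) :
    ‖taylorCoeff F n * coeffTX (jetMonomial u n) (k + 1) l‖ ≤
      c.K * c.P * (4 * c.ρ) * c.scale k l * (1 / 2) ^ (∑ v, n v) := by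
  have hR := c.radius_pos
  have hA := c.ratio_pos
  have hρ := c.ρ_pos
  have hK := c.K_pos
  have hP := c.P_pos
  have hJ := c.jetFactor_nonneg
  have hθ := theta_nonneg (irregularity F) (3 * m * k + m) l
  have hV := c.scale_nonneg k l
  by_cases h0 : taylorCoeff F n = 0
  · rw [h0, zero_mul, norm_zero]; positivity
  have hjet := hu.rowBound_jetMonomial (one_le_irregularity F) hm hR c.radius_le_one hA
    c.amplitude_nonneg c.irregularity_mul_le hn (fun _ => hσ.add_lossExponent_le hn h0) l
  rw [coeff_row, ← jetFactor] at hjet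
  have htaylor := c.norm_taylorCoeff_le n
  have hpoly := c.pow_le_two_pow (n (varT m) + zDegree n)
  have hweight := c.monomial_weight_le hn
  have hx := c.ρ_mul_radius_le
  rw [sum_eq_add_zDegree] at htaylor ⊢
  generalize n (varT m) = i, n (varX m) = x, zDegree n = z at *
  rw [norm_mul]
  calc ‖taylorCoeff F n‖ * ‖coeffTX (jetMonomial u n) (k + 1) l‖
      ≤ c.K * c.ρ ^ (i + x + z) * (c.jetFactor ^ z * c.radius ^ x *
          (c.ratio ^ (k + 1) / c.ratio ^ (i + z)) *
          (((i + z : ℕ) : ℝ) ^ (c.T + 2) / ((k + 1 : ℕ) : ℝ) ^ (c.T + 2)) *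
          theta (irregularity F) (3 * m * k + m) l / c.radius ^ l) :=
        mul_le_mul htaylor hjet (norm_nonneg _) (by positivity)
    _ ≤ c.K * c.ρ ^ (i + x + z) * (c.jetFactor ^ z * c.radius ^ x *
          (c.ratio ^ (k + 1) / c.ratio ^ (i + z)) *
          (c.P * 2 ^ (i + z) / ((k + 1 : ℕ) : ℝ) ^ (c.T + 2)) *
          theta (irregularity F) (3 * m * k + m) l / c.radius ^ l) := by gcongr
    _ = c.K * c.P * c.scale k l * (c.jetFactor ^ z * (2 * c.ρ) ^ (i + z) *
          (c.ratio / c.ratio ^ (i + z))) * (c.ρ * c.radius) ^ x := by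
        rw [scale]; push_cast; ring
    _ ≤ c.K * c.P * c.scale k l * (4 * c.ρ * (1 / 2) ^ (i + z)) * (1 / 2) ^ x := by gcongr
    _ = c.K * c.P * (4 * c.ρ) * c.scale k l * (1 / 2) ^ (i + x + z) := by ring

theorem norm_rest_le (hm : 1 ≤ m) (hσ : IrregularityBound F) {k : ℕ} (hu : c.Bounds k u) (l : ℕ) :
    ‖rest F u (k + 1) l‖ ≤ c.restFactor * c.scale k l := by
  have hρ := c.ρ_pos
  have hK := c.K_pos
  have hP := c.P_pos
  have hV := c.scale_nonneg k l
  calc ‖rest F u (k + 1) l‖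
      ≤ ∑ n ∈ (box m (k + 1 + l)).filter IsRest,
          c.K * c.P * (4 * c.ρ) * c.scale k l * (1 / 2) ^ (∑ v, n v) :=
        norm_sum_le_of_le _ fun n hn => c.norm_rest_term_le hm hσ hu (mem_filter.1 hn).2 l
    _ ≤ c.K * c.P * (4 * c.ρ) * c.scale k l * 2 ^ Fintype.card (Var m) := by
        rw [← Finset.mul_sum]
        gcongr
        exact (Finset.sum_le_sum_of_subset_of_nonneg (Finset.filter_subset _ _)
          fun _ _ _ => by positivity).trans (sum_box_half_pow_le m _)
    _ = c.restFactor * c.scale k l := by rw [restFactor]; ring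

/-- The gain `k^{-m}` of the inverse of the indicial polynomial turns the weight `k^{-(T+2)}` of
`scale` into the weight of the majorant of the solution. -/
theorem norm_rest_le_half (hm : 1 ≤ m) (hσ : IrregularityBound F) {k : ℕ} (hu : c.Bounds k u)
    (l : ℕ) :
    ‖rest F u (k + 1) l‖ ≤ 1 / 2 * (‖indicial F ((k + 1 : ℕ) : ℂ) l‖ *
      (c.amplitude * c.ratio ^ k / ((k : ℝ) + 1) ^ (m + (c.T + 2)) *
        theta (irregularity F) (3 * m * k + m) l / c.radius ^ l)) := by
  have hH := c.restFactor_nonneg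
  have hV := c.scale_nonneg k l
  have hC := c.C_pos
  have hind : 1 ≤ c.C * ‖indicial F ((k + 1 : ℕ) : ℂ) l‖ / ((k : ℝ) + 1) ^ m := by
    rw [one_le_div (by positivity)]
    exact_mod_cast c.pow_le_indicial (k + 1) l (Nat.le_add_left 1 k)
  calc ‖rest F u (k + 1) l‖ ≤ c.restFactor * c.scale k l := c.norm_rest_le hm hσ hu l
    _ ≤ c.restFactor * c.scale k l *
        (c.C * ‖indicial F ((k + 1 : ℕ) : ℂ) l‖ / ((k : ℝ) + 1) ^ m) :=
        le_mul_of_one_le_right (by positivity) hind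
    _ = _ := by rw [scale, amplitude, pow_add _ m]; field_simp

theorem norm_coeff_coeffC_le {q : ℕ × ℕ} (hq : q ∈ indexSet m) (p : ℕ) :
    ‖PowerSeries.coeff p (coeffC F q)‖ ≤ c.K * c.ρ ^ (m + 1) * c.ρ ^ p := by
  have hcoeff : PowerSeries.coeff p (coeffC F q) =
      taylorCoeff F (linExponent ⟨q, hq⟩ (p + q.2)) := by
    rw [coeff_coeffC F ⟨q, hq⟩, coeffB, PowerSeries.coeff_mk, taylorCoeff, linExponent,
      Finsupp.equivFunOnFinite_symm_coe]
  have hdeg : ∑ v, linExponent ⟨q, hq⟩ (p + q.2) v = p + q.2 + 1 := by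
    simp [linExponent, Finset.sum_add_distrib]
  have hq := mem_indexSet.1 hq
  have hK := c.K_pos
  rw [hcoeff, mul_assoc, ← pow_add]
  refine (c.norm_taylorCoeff_le _).trans ?_
  rw [hdeg]
  exact mul_le_mul_of_nonneg_left (pow_le_pow_right₀ c.one_le_ρ (by omega)) hK.le

theorem norm_linTerm_le {k l a : ℕ} {E : ℝ} (hk : 1 ≤ k) (ha : 1 ≤ a) (hE : 0 ≤ E)
    (hu : ∀ l' < l, ‖coeffTX u k l'‖ ≤ E * theta (irregularity F) a l' / c.radius ^ l')
    {q : ℕ × ℕ} (hq : q ∈ indexSet m) {p : ℕ} (hp : p ∈ Ico 1 (l + 1)) :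
    ‖linTerm F u k l q p‖ ≤ c.K * c.ρ ^ (m + 1) * c.C *
      (‖indicial F k l‖ * (E * theta (irregularity F) a l / c.radius ^ l)) *
      (c.ρ * c.radius) ^ p := by
  obtain ⟨hp1, hpl⟩ : 1 ≤ p ∧ p ≤ l := by rw [mem_Ico] at hp; omega
  have hR := c.radius_pos
  have hρ := c.ρ_pos
  have hK := c.K_pos
  have hC := c.C_pos
  have hθl := theta_nonneg (irregularity F) a l
  have hθ := theta_nonneg (irregularity F) a (l - p)
  by_cases h0 : PowerSeries.coeff p (coeffC F q) = 0
  · rw [linTerm, h0, zero_mul, norm_zero]; positivity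
  have hmono := c.mono_le_indicial q hq k l p hk (hp1.trans hpl) hpl h0
  have htheta := theta_mul_descFactorial_le (zero_le_one.trans (one_le_irregularity F)) ha hpl
  have hdesc : ((l - p).descFactorial q.2 : ℝ) ≤ (l : ℝ) ^ q.2 := by
    exact_mod_cast (Nat.descFactorial_le_pow (l - p) q.2).trans
      (Nat.pow_le_pow_left (Nat.sub_le l p) _)
  have hderiv : (k : ℝ) ^ q.1 * (((l - p).descFactorial q.2 : ℝ) * ‖coeffTX u k (l - p)‖) ≤
      c.C * (‖indicial F k l‖ * (E * theta (irregularity F) a l / c.radius ^ l)) *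
        c.radius ^ p :=
    calc (k : ℝ) ^ q.1 * (((l - p).descFactorial q.2 : ℝ) * ‖coeffTX u k (l - p)‖)
        ≤ (k : ℝ) ^ q.1 * ((l : ℝ) ^ q.2 *
            (E * theta (irregularity F) a (l - p) / c.radius ^ (l - p))) := by
          gcongr
          exact hu _ (by omega)
      _ = mono k l q * (E * theta (irregularity F) a (l - p) / c.radius ^ (l - p)) := by
          rw [mono]; ring
      _ ≤ c.C * ‖indicial F k l‖ * (l.descFactorial p : ℝ) ^ (irregularity F - 1) *
          (E * theta (irregularity F) a (l - p) / c.radius ^ (l - p)) := by gcongr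
      _ = c.C * ‖indicial F k l‖ * E / c.radius ^ (l - p) * (theta (irregularity F) a (l - p) *
          (l.descFactorial p : ℝ) ^ (irregularity F - 1)) := by ring
      _ ≤ c.C * ‖indicial F k l‖ * E / c.radius ^ (l - p) * theta (irregularity F) a l := by gcongr
      _ = _ := by rw [pow_sub₀ _ hR.ne' hpl]; field_simp
  rw [linTerm, norm_mul, norm_mul, norm_mul, norm_pow, Complex.norm_natCast, Complex.norm_natCast,
    mul_pow]
  exact (mul_le_mul (c.norm_coeff_coeffC_le hq p) hderiv (by positivity)
    (by positivity)).trans_eq (by ring)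

theorem norm_sum_linTerm_le_half {k l a : ℕ} {E : ℝ} (hk : 1 ≤ k) (ha : 1 ≤ a) (hE : 0 ≤ E)
    (hu : ∀ l' < l, ‖coeffTX u k l'‖ ≤ E * theta (irregularity F) a l' / c.radius ^ l') :
    ‖∑ q ∈ indexSet m, ∑ p ∈ Ico 1 (l + 1), linTerm F u k l q p‖ ≤
      1 / 2 * (‖indicial F k l‖ * (E * theta (irregularity F) a l / c.radius ^ l)) := by
  have hR := c.radius_pos
  have hρ := c.ρ_pos
  have hK := c.K_pos
  have hC := c.C_pos
  have hθ := theta_nonneg (irregularity F) a l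
  set W : ℝ := ‖indicial F k l‖ * (E * theta (irregularity F) a l / c.radius ^ l) with hW
  have hW0 : 0 ≤ W := by positivity
  calc _ ≤ ∑ _q ∈ indexSet m, ∑ p ∈ Ico 1 (l + 1),
        c.K * c.ρ ^ (m + 1) * c.C * W * (c.ρ * c.radius) ^ p :=
        norm_sum_le_of_le _ fun _ hq => norm_sum_le_of_le _ fun _ hp =>
          c.norm_linTerm_le hk ha hE hu hq hp
    _ = (indexSet m).card *
        (c.K * c.ρ ^ (m + 1) * c.C * W * ∑ p ∈ Ico 1 (l + 1), (c.ρ * c.radius) ^ p) := by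
        simp only [Finset.sum_const, nsmul_eq_mul, ← Finset.mul_sum]
    _ ≤ (indexSet m).card * (c.K * c.ρ ^ (m + 1) * c.C * W * (2 * (c.ρ * c.radius))) := by
        gcongr
        exact sum_Ico_one_pow_le (by positivity) c.ρ_mul_radius_le l
    _ = (indexSet m).card * (c.K * c.ρ ^ (m + 1) * c.C * (2 * (c.ρ * c.radius))) * W := by ring
    _ ≤ 1 / 2 * W := by gcongr; exact c.card_mul_radius_le

theorem bounds (hm : 1 ≤ m) (hN : NonResonance F) (hσ : IrregularityBound F)
    (hu : ∀ k l : ℕ, 1 ≤ k → indicial F k l * coeffTX u k l = recursionRHS F u k l) (N : ℕ) :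
    c.Bounds N u := by
  induction N with
  | zero => exact fun k hk => absurd hk k.not_lt_zero
  | succ N ihN =>
    intro k hk
    rcases Nat.lt_succ_iff_lt_or_eq.1 hk with hk | rfl
    · exact ihN k hk
    intro l
    rw [coeff_row]
    induction l using Nat.strong_induction_on with
    | _ l ihl =>
      have hA := c.ratio_pos
      have hε := c.amplitude_nonneg
      have hlin := c.norm_sum_linTerm_le_half (Nat.le_add_left 1 k) (by omega) (by positivity) ihl
      have hrest := c.norm_rest_le_half hm hσ ihN l
      refine le_of_mul_le_mul_left ?_ (norm_pos_iff.2 (hN (k + 1) l (Nat.le_add_left 1 k)))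
      rw [← norm_mul, hu (k + 1) l (Nat.le_add_left 1 k), recursionRHS]
      refine (norm_add_le _ _).trans ((add_le_add hlin hrest).trans_eq ?_)
      ring

end GrowthConstants

/-! ### Convergence -/

theorem SolutionBound.exists_norm_coeffTX_le {σ R A ε : ℝ} {m S : ℕ}
    {u : MvPowerSeries (Fin 2) ℂ} (hσ : 0 ≤ σ) (hR : 0 < R) (hA : 0 < A) (hε : 0 ≤ ε)
    (hu0 : ∀ l, coeffTX u 0 l = 0) (hu : ∀ N, SolutionBound σ R A ε m S N u) :
    ∃ D a b : ℝ, 0 ≤ D ∧ 0 < a ∧ 0 < b ∧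
      ∀ k l, ‖coeffTX u k l‖ ≤ D * a ^ k * b ^ l * (l ! : ℝ) ^ (σ - 1) := by
  obtain ⟨Q, hQ⟩ : ∃ Q : ℝ, Q = (2 : ℝ) ^ σ := ⟨_, rfl⟩
  have hQ0 : 0 < Q := by rw [hQ]; positivity
  have hpow (n : ℕ) : ((2 : ℝ) ^ n) ^ σ = Q ^ n := by rw [hQ, Real.rpow_pow_comm zero_le_two]
  refine ⟨ε * Q ^ m, max 1 (A * Q ^ (3 * m)), Q / R, by positivity, by positivity, by positivity,
    fun k l => ?_⟩
  cases k with
  | zero => rw [hu0, norm_zero]; positivity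
  | succ k =>
    have hrow := hu (k + 1) k (Nat.lt_succ_self k) l
    rw [coeff_row] at hrow
    have hθ := theta_nonneg σ (3 * m * k + m) l
    have hθQ := theta_le hσ (3 * m * k + m) l
    rw [hpow] at hθQ
    have hpowA : (A * Q ^ (3 * m)) ^ k ≤ max 1 (A * Q ^ (3 * m)) ^ (k + 1) :=
      (pow_le_pow_left₀ (by positivity) (le_max_right _ _) k).trans
        (pow_le_pow_right₀ (le_max_left _ _) (Nat.le_succ k))
    calc ‖coeffTX u (k + 1) l‖
        ≤ ε * A ^ k / ((k : ℝ) + 1) ^ S * theta σ (3 * m * k + m) l / R ^ l := hrow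
      _ ≤ ε * A ^ k * (Q ^ (3 * m * k + m + l) * (l ! : ℝ) ^ (σ - 1)) / R ^ l := by
          gcongr
          exact div_le_self (by positivity) (one_le_pow₀ (by linarith [k.cast_nonneg (α := ℝ)]))
      _ = ε * Q ^ m * (A * Q ^ (3 * m)) ^ k * (Q / R) ^ l * (l ! : ℝ) ^ (σ - 1) := by
          rw [pow_add, pow_add, pow_mul, mul_pow, div_pow]; field_simp
      _ ≤ _ := by gcongr

theorem mem_gevreyClass_of_norm_coeffTX_le {σ D a b : ℝ} {u : MvPowerSeries (Fin 2) ℂ}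
    (hD : 0 ≤ D) (ha : 0 < a) (hb : 0 < b)
    (hu : ∀ k l, ‖coeffTX u k l‖ ≤ D * a ^ k * b ^ l * (l ! : ℝ) ^ (σ - 1)) :
    u ∈ gevreyClass 1 σ := by
  have hball : ∀ᶠ P : ℂ × ℂ in 𝓝 0, a * ‖P.1‖ < 1 / 2 ∧ b * ‖P.2‖ < 1 / 2 :=
    ((ContinuousAt.eventually_lt (by fun_prop) continuousAt_const (by simp)).and
      (ContinuousAt.eventually_lt (by fun_prop) continuousAt_const (by simp)))
  filter_upwards [hball] with P hP
  have hgeom : Summable fun n : ℕ × ℕ => D * ((1 / 2 : ℝ) ^ n.1 * (1 / 2 : ℝ) ^ n.2) :=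
    (summable_geometric_two.mul_of_nonneg summable_geometric_two
      (fun _ => by positivity) (fun _ => by positivity)).mul_left D
  refine Summable.of_norm_bounded hgeom fun n => ?_
  have hfac : (0 : ℝ) < (n.2 ! : ℝ) ^ (σ - 1) := by positivity
  rw [sub_self, Real.rpow_zero, one_mul, norm_mul, norm_mul, norm_div, norm_pow, norm_pow,
    Complex.norm_real, Real.norm_of_nonneg hfac.le]
  calc ‖coeffTX u n.1 n.2‖ / (n.2 ! : ℝ) ^ (σ - 1) * ‖P.1‖ ^ n.1 * ‖P.2‖ ^ n.2
      ≤ D * a ^ n.1 * b ^ n.2 * (n.2 ! : ℝ) ^ (σ - 1) / (n.2 ! : ℝ) ^ (σ - 1) *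
        ‖P.1‖ ^ n.1 * ‖P.2‖ ^ n.2 := by gcongr; exact hu _ _
    _ = D * ((a * ‖P.1‖) ^ n.1 * (b * ‖P.2‖) ^ n.2) := by
        rw [mul_pow, mul_pow]; field_simp
    _ ≤ D * ((1 / 2) ^ n.1 * (1 / 2) ^ n.2) := by
        gcongr
        · exact hP.1.le
        · exact hP.2.le

theorem holomorphicInT_of_mem_gevreyClass {σ : ℝ} {u : MvPowerSeries (Fin 2) ℂ}
    (hu : u ∈ gevreyClass 1 σ) : HolomorphicInT u := by
  obtain ⟨ε, hε, hball⟩ := Metric.eventually_nhds_iff.1 hu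
  have hpos : 0 < ε / 2 := half_pos hε
  have hP := hball (y := (((ε / 2 : ℝ) : ℂ), ((ε / 2 : ℝ) : ℂ))) (by
    rw [dist_zero_right, Prod.norm_def, Complex.norm_real, Real.norm_of_nonneg hpos.le, max_self]
    exact half_lt_self hε)
  refine ⟨ε / 2, hpos, fun l t => ∑' k, coeffTX u k l * t ^ k, fun l => ?_⟩
  have hsum : Summable fun k => ‖coeffTX u k l‖ * (ε / 2) ^ k := by
    have hrow := (hP.comp_injective (Prod.mk_left_injective l)).norm
    have hfac : (0 : ℝ) < (l ! : ℝ) ^ (σ - 1) := by positivity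
    refine (hrow.mul_right ((l ! : ℝ) ^ (σ - 1) / (ε / 2) ^ l)).congr fun k => ?_
    simp only [Function.comp_apply, sub_self, Real.rpow_zero, one_mul, norm_mul, norm_div, norm_pow,
      Complex.norm_real, Real.norm_of_nonneg hfac.le, Real.norm_of_nonneg hpos.le]
    field_simp
  have hle : ∀ k : ℕ, ∀ t ∈ Metric.ball (0 : ℂ) (ε / 2),
      ‖coeffTX u k l * t ^ k‖ ≤ ‖coeffTX u k l‖ * (ε / 2) ^ k := fun k t ht => by
    rw [norm_mul, norm_pow]
    gcongr
    exact (mem_ball_zero_iff.1 ht).le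
  exact ⟨Complex.differentiableOn_tsum_of_summable_norm hsum (fun k => by fun_prop)
    Metric.isOpen_ball hle, fun t ht => (Summable.of_norm_bounded hsum fun k => hle k t ht).hasSum⟩

end TotChar

end

theorem corollary2p6 (m : ℕ) (hm : 1 ≤ m) (F : (TotChar.Var m → ℂ) → ℂ)
    (r : TotChar.Var m → ℝ) (hr : ∀ v, 0 < r v)
    (hA1 : AnalyticOnNhd ℂ F (TotChar.polydisk r))
    (hA2 : ∀ z ∈ TotChar.polydisk r, (∀ v, v ≠ TotChar.varX m → z v = 0) → F z = 0)
    (hA3 : TotChar.TotallyCharacteristic F)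
    (hN : TotChar.NonResonance F)
    (hGP : TotChar.GeneralizedPoincare F)
    (hσ : ∀ mu : ℕ, mu < m → ∀ q ∈ TotChar.indexSetMu F mu,
      TotChar.irregularity F ≤ ((m : ℝ) - q.1.1 - mu) / ((q.1.2 : ℝ) - mu)) :
    ∃ u : MvPowerSeries (Fin 2) ℂ,
      TotChar.IsFormalSolution F u ∧
      (∀ v : MvPowerSeries (Fin 2) ℂ, TotChar.IsFormalSolution F v → v = u) ∧
      u ∈ TotChar.gevreyClass 1 (TotChar.irregularity F) ∧
      TotChar.HolomorphicInT u := by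
  have hF : AnalyticAt ℂ F 0 := hA1 0 fun v => by simpa using hr v
  have hvan : ∀ l, MvPowerSeries.coeff (Finsupp.single (TotChar.varX m) l)
      (TotChar.taylorSeries F) = 0 :=
    TotChar.coeff_taylorSeries_single_eq_zero hF _ (by
      filter_upwards [Metric.ball_mem_nhds (0 : ℂ) (hr (TotChar.varX m))] with x hx
      exact hA2 _ (TotChar.single_mem_polydisk hr (mem_ball_zero_iff.1 hx))
        fun v hv => Pi.single_eq_of_ne hv _)
  obtain ⟨u, ⟨hu0, hu⟩, huniq⟩ := TotChar.existsUnique_recursion hN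
  obtain ⟨c⟩ := TotChar.nonempty_growthConstants hF hN hGP
  obtain ⟨D, a, b, hD, ha, hb, hle⟩ := TotChar.SolutionBound.exists_norm_coeffTX_le
    (zero_le_one.trans (TotChar.one_le_irregularity F)) c.radius_pos c.ratio_pos
    c.amplitude_nonneg hu0 (c.bounds hm hN hσ hu)
  have hG := TotChar.mem_gevreyClass_of_norm_coeffTX_le hD ha hb hle
  exact ⟨u, (TotChar.isFormalSolution_iff hA3 hvan u).2 ⟨hu0, hu⟩,
    fun v hv => huniq v ((TotChar.isFormalSolution_iff hA3 hvan v).1 hv), hG,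
    TotChar.holomorphicInT_of_mem_gevreyClass hG⟩
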